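/- Let $n\ge 1$, $s>1$, $0<\alpha<n/s$, $0<r\le s$, $p>1$ and $p'=\frac{p}{p-1}$. "Measurable" means Lebesgue measurable on $\mathbb R^n$, functions that agree a.e. are identified, and $\inf\emptyset=+\infty$. For measurable $f\ge 0$ let $$I_\alpha f(x)=\gamma(n,\alpha)\int_{\mathbb R^n}|x-y|^{\alpha-n}f(y)\,dy,\qquad \gamma(n,\alpha)=\frac{\Gamma(\frac{n-\alpha}{2})}{\pi^{n/2}2^{\alpha}\Gamma(\frac{\alpha}{2})},$$ and for $E\subset\mathbb R^n$ let $$\mathrm{cap}_{\alpha,s}(E)=\inf\{\|f\|_{L^s(\mathbb R^n)}^s: 0\le f\in L^s(\mathbb R^n),\ I_\alpha f\ge 1\text{ on }E\}.$$ Quasi-everywhere (q.e.) means outside a set $E$ with $\mathrm{cap}_{\alpha,s}(E)=0$. **The space $\dot M^{\alpha,s}_{p,r}$** consists of all $f\in L^p_{\rm loc}(\mathbb R^n)$ for which there is a finite constant $C\ge0$ with $$\Big(\int_{\mathbb R^n}(I_\alpha h)^r|f|^p\,dx\Big)^{1/p}\le C\,\|h\|_{L^s(\mathbb R^n)}^{r/p}\qquad\text{for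 all }0\le h\in L^s(\mathbb R^n);$$ $\|f\|_{\dot M^{\alpha,s}_{p,r}}$ is the least such $C$. **The space $\dot{\overline N}{}^{\alpha,s}_{p',s/r}$.** For a q.e. defined function $w\ge0$ put $$\|w\|_{\dot F}=\inf\{\|f\|_{L^s(\mathbb R^n)}^r: 0\le f\in L^s(\mathbb R^n),\ I_\alpha f\ge w^{1/r}\text{ q.e.}\}.$$ A weight is a nonnegative locally integrable function. For measurable $g$ put $$\|g\|_{\dot{\overline N}{}^{\alpha,s}_{p',s/r}}=\inf_w\Big(\int_{\{g\ne0\}}|g|^{p'}w^{1-p'}\,dx\Big)^{1/p'},$$ the infimum being over all q.e. defined weights $w$ with $\|w\|_{\dot F}\le1$ (where $w^{1-p'}=+\infty$ at points with $w=0$). The space $\dot{\overline N}{}^{\alpha,s}_{p',s/r}$ consists of all measurable $g$ for which this is finite. **Köthe duals.** For either of these spaces $X$, the Köthe dual $X'$ consists of all measurable $g$ with $fg\in L^1(\mathbb R^n)$ for all $f\in X$, with norm $\|g\|_{X'}=\sup\{\int_{\mathbb R^n}|fg|\,dx: f\in X,\ \|f\|_X\le1\}$. **Theorem.** The following equalities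 hold as sets of functions and with equality of norms: $$\dot{\overline N}{}^{\alpha,s}_{p',s/r}=(\dot M^{\alpha,s}_{p,r})',\qquad (\dot{\overline N}{}^{\alpha,s}_{p',s/r})'=\dot M^{\alpha,s}_{p,r}.$$ Moreover, in both cases the two norm expressions, regarded as elements of $[0,+\infty]$, agree for every measurable function. -/

import Mathlib

open MeasureTheory
open scoped ENNReal NNReal

noncomputable section

namespace RieszMultiplier

/-- `ℝⁿ` with its Euclidean norm and Lebesgue measure. -/
abbrev Rn (n : ℕ) : Type := EuclideanSpace ℝ (Fin n)

/-- The normalizing constant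
`γ(n, α) = Γ((n - α) / 2) / (π ^ (n / 2) * 2 ^ α * Γ(α / 2))` of the Riesz kernel. -/
def rieszConst (n : ℕ) (α : ℝ) : ℝ :=
  Real.Gamma (((n : ℝ) - α) / 2) /
    (Real.pi ^ ((n : ℝ) / 2) * (2 : ℝ) ^ α * Real.Gamma (α / 2))

/-- The Riesz potential `I_α f (x) = γ(n, α) ∫ |x - y| ^ (α - n) f(y) dy` of a nonnegative
function, with values in `[0, ∞]`. -/
def rieszPotential {n : ℕ} (α : ℝ) (f : Rn n → ℝ≥0∞) (x : Rn n) : ℝ≥0∞ :=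
  ENNReal.ofReal (rieszConst n α) * ∫⁻ y, ‖x - y‖ₑ ^ (α - (n : ℝ)) * f y

/-- `f` is a nonnegative element of `L^s(ℝⁿ)`. The values are taken in `[0, ∞]`; such an `f` is
finite almost everywhere. -/
def IsNonnegLs {n : ℕ} (s : ℝ) (f : Rn n → ℝ≥0∞) : Prop :=
  AEMeasurable f ∧ eLpNorm f (ENNReal.ofReal s) volume < ∞

/-- The Riesz capacity
`cap_{α,s}(E) = inf { ‖f‖_{L^s}^s : f ≥ 0, I_α f ≥ 1 on E }` of an arbitrary set `E`. -/
def rieszCap {n : ℕ} (α s : ℝ) (E : Set (Rn n)) : ℝ≥0∞ :=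
  ⨅ (f : Rn n → ℝ≥0∞) (_ : IsNonnegLs s f) (_ : ∀ x ∈ E, 1 ≤ rieszPotential α f x),
    eLpNorm f (ENNReal.ofReal s) volume ^ s

/-- `P` holds quasi-everywhere: outside a set of zero capacity `cap_{α,s}`. -/
def QuasiEverywhere {n : ℕ} (α s : ℝ) (P : Rn n → Prop) : Prop :=
  rieszCap α s {x | ¬ P x} = 0

/-- `‖u‖_F = inf { ‖f‖_{L^s}^r : f ≥ 0, I_α f ≥ u^{1/r} q.e. }` (and `∞` if there is no such `f`),
for a nonnegative function `u` defined q.e. Only the q.e. class of `u` matters, so `u` is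
represented by a function defined everywhere. -/
def fNorm {n : ℕ} (α s r : ℝ) (u : Rn n → ℝ≥0∞) : ℝ≥0∞ :=
  ⨅ (f : Rn n → ℝ≥0∞) (_ : IsNonnegLs s f)
    (_ : QuasiEverywhere α s (fun x => u x ^ (1 / r) ≤ rieszPotential α f x)),
    eLpNorm f (ENNReal.ofReal s) volume ^ r

/-- A weight: a nonnegative, locally integrable function. -/
def IsWeight {n : ℕ} (w : Rn n → ℝ≥0∞) : Prop :=
  AEMeasurable w ∧ ∀ K : Set (Rn n), IsCompact K → ∫⁻ x in K, w x < ∞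

/-- `‖g‖ = inf_w (∫ |g|^q w^{1-q} dx)^{1/q}` over all weights `w` with `‖w‖_F ≤ 1`, for `q > 1`.
The integral is the one over `{g ≠ 0}`: where `g = 0` the integrand is `0`, also if `w = 0`
(in `[0, ∞]` one has `0 ^ (1 - q) = ∞` and `0 * ∞ = 0`); where `w = 0` and `g ≠ 0` it is `∞`. -/
def nBarNorm {n : ℕ} (α s r q : ℝ) (g : Rn n → ℝ) : ℝ≥0∞ :=
  ⨅ (w : Rn n → ℝ≥0∞) (_ : IsWeight w) (_ : fNorm α s r w ≤ 1),
    (∫⁻ x, ‖g x‖ₑ ^ q * w x ^ (1 - q)) ^ (1 / q)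

/-- The space `N̄^{α,s}_{q, s/r}`. -/
def nBarSpace (n : ℕ) (α s r q : ℝ) : Set (Rn n → ℝ) :=
  {g | AEMeasurable g ∧ nBarNorm α s r q g < ∞}

/-- The trace inequality `(∫ (I_α h)^r |f|^p dx)^{1/p} ≤ C ‖h‖_{L^s}^{r/p}` for all nonnegative
`h` in `L^s`. -/
def TraceInequality {n : ℕ} (α s p r : ℝ) (f : Rn n → ℝ) (C : ℝ≥0) : Prop :=
  ∀ h : Rn n → ℝ≥0∞, IsNonnegLs s h →
    (∫⁻ x, rieszPotential α h x ^ r * ‖f x‖ₑ ^ p) ^ (1 / p) ≤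
      C * eLpNorm h (ENNReal.ofReal s) volume ^ (r / p)

/-- The space `M^{α,s}_{p,r}` of all `f ∈ L^p_loc` that satisfy a trace inequality. -/
def mSpace (n : ℕ) (α s p r : ℝ) : Set (Rn n → ℝ) :=
  {f | AEMeasurable f ∧
    (∀ K : Set (Rn n), IsCompact K → MemLp f (ENNReal.ofReal p) (volume.restrict K)) ∧
    ∃ C : ℝ≥0, TraceInequality α s p r f C}

/-- The norm of `M^{α,s}_{p,r}`: the least constant in the trace inequality (`∞` if there is no
such constant). -/
def mNorm {n : ℕ} (α s p r : ℝ) (f : Rn n → ℝ) : ℝ≥0∞ :=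
  ⨅ (C : ℝ≥0) (_ : TraceInequality α s p r f C), (C : ℝ≥0∞)

/-- The Köthe dual of a space `X` of measurable functions: all measurable `g` with `f g ∈ L¹` for
every `f ∈ X`. -/
def kotheDual {n : ℕ} (X : Set (Rn n → ℝ)) : Set (Rn n → ℝ) :=
  {g | AEMeasurable g ∧ ∀ f ∈ X, Integrable (fun x => f x * g x)}

/-- The Köthe dual norm `sup { ∫ |f g| dx : f ∈ X, ‖f‖_X ≤ 1 }`, where `ρ` is the norm of `X`. -/
def kotheDualNorm {n : ℕ} (X : Set (Rn n → ℝ)) (ρ : (Rn n → ℝ) → ℝ≥0∞) (g : Rn n → ℝ) : ℝ≥0∞ :=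
  ⨆ (f : Rn n → ℝ) (_ : f ∈ X) (_ : ρ f ≤ 1), ∫⁻ x, ‖f x * g x‖ₑ

/-- Two spaces of measurable functions coincide isometrically: they have the same elements, and
the two norms (with values in `[0, ∞]`) agree on every measurable function. -/
def IsometricallyEqual {n : ℕ} (X : Set (Rn n → ℝ)) (ρ : (Rn n → ℝ) → ℝ≥0∞)
    (Y : Set (Rn n → ℝ)) (σ : (Rn n → ℝ) → ℝ≥0∞) : Prop :=
  X = Y ∧ ∀ g : Rn n → ℝ, AEMeasurable g → ρ g = σ g

end RieszMultiplier

end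

namespace RieszMultiplier

open Filter Topology

/-! ### Riesz potentials on L^s: integral bounds from splitting the kernel -/

section

/-! Write q = p' and let B be the set of nonnegative h in the unit ball of L^s. Zero capacity
implies zero measure, so every admissible weight is, up to a factor arbitrarily close to 1,
dominated a.e. by some (I_α h)^r with h in B, and these powers are themselves admissible. Hence the
N̄-norm to the power q is the infimum over B of ∫ |g|^q (I_α h)^{r(1-q)}, while the M-norm to the
power p is the supremum over B of ∫ (I_α h)^r |f|^p. Hölder's inequality with weight (I_α h)^r gives
∫ |fg| ≤ ‖f‖_M ‖g‖_N̄, and both dualities reduce to its equality case.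

For M as a dual, fix h and set w = (I_α h)^r. Normalized truncations of w |f|^{p-1} lie in the unit
ball of N̄ and recover ∫ w |f|^p (`lintegral_rieszPotential_rpow_le_of_dual`).

For N̄ as a dual, the infimum is attained at some h₀ in B. Put a = (I_α h₀)^r and let N be the norm
of g. Up to domination the functions (I_α h)^r form a convex set
(`exists_mem_lsBall_combination_le`, by Minkowski's inequality and r ≤ s), so the first variation at
the minimizer reads ∫ |g|^q (I_α h)^r a^{-q} ≤ N^q for all h in B. This says exactly that f =
N^{1-q} |g|^{q-1} a^{1-q} has M-norm at most 1, and ∫ f |g| = N (`exists_mNorm_le_one_nBarNorm_le`).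

Attainment and the Fatou property of N̄ come from one compactness argument
(`exists_mem_lsBall_lintegral_rpow_neg_le`): almost minimizers of a strictly convex functional on
decreasing convex sets converge a.e. along a subsequence, and along a further subsequence their
potentials are asymptotically at most that of the limit, which suffices because negative powers are
decreasing. The Fatou property extends the first norm identity to g of infinite norm by truncation.
A gliding hump shows that membership in a Köthe dual forces a finite dual norm, which turns the norm
identities into equalities of sets. -/

theorem ennreal_rpow_le_rpow_of_nonpos {x y : ℝ≥0∞} {z : ℝ} (hxy : x ≤ y) (hz : z ≤ 0) :
    y ^ z ≤ x ^ z := by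
  rw [← neg_neg z, ENNReal.rpow_neg y, ENNReal.rpow_neg x, ENNReal.inv_le_inv]
  exact ENNReal.rpow_le_rpow hxy (by linarith)

theorem ennreal_mul_rpow_of_neg {b y : ℝ≥0∞} {z : ℝ} (hb0 : b ≠ 0) (hb : b ≠ ∞) (hz : z < 0) :
    (b * y) ^ z = b ^ z * y ^ z := by
  by_cases hy : y = 0
  · rw [hy, mul_zero, ENNReal.zero_rpow_of_neg hz, ENNReal.mul_top]
    exact (ENNReal.rpow_pos (pos_iff_ne_zero.2 hb0) hb).ne'
  · exact ENNReal.mul_rpow_of_ne_zero hb0 hy _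

/-! ### Convolution inequalities -/

/-- Jensen's inequality for the unnormalized measure k dμ, obtained from Hölder with the splitting k
= k^{1/σ} k^{1/τ}. -/
theorem lintegral_mul_rpow_le {X : Type*} [MeasurableSpace X] (μ : Measure X) {k f : X → ℝ≥0∞}
    (hk : AEMeasurable k μ) (hf : AEMeasurable f μ) {σ : ℝ} (hσ : 1 ≤ σ) :
    (∫⁻ x, k x * f x ∂μ) ^ σ ≤ (∫⁻ x, k x ∂μ) ^ (σ - 1) * ∫⁻ x, k x * f x ^ σ ∂μ := by
  rcases hσ.eq_or_lt with rfl | hσ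
  · simp
  have hc := Real.HolderConjugate.conjExponent hσ
  set τ := σ.conjExponent
  have hσ0 : 0 < σ := hc.pos
  have hτ0 : 0 < τ := hc.symm.pos
  have h1 := ENNReal.lintegral_mul_le_Lp_mul_Lq μ hc
    ((hk.pow_const (1 / σ)).mul hf) (hk.pow_const (1 / τ))
  have e1 : ∀ x, ((fun x => k x ^ (1 / σ)) * f * fun x => k x ^ (1 / τ)) x = k x * f x := by
    intro x
    simp only [Pi.mul_apply]
    rw [mul_right_comm, ← ENNReal.rpow_add_of_nonneg _ _ (by positivity) (by positivity)]
    rw [one_div, one_div, hc.inv_add_inv_eq_one, ENNReal.rpow_one]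
  have e2 : ∀ x, ((fun x => k x ^ (1 / σ)) * f) x ^ σ = k x * f x ^ σ := by
    intro x
    simp only [Pi.mul_apply]
    rw [ENNReal.mul_rpow_of_nonneg _ _ hσ0.le, ← ENNReal.rpow_mul, one_div_mul_cancel hσ0.ne',
      ENNReal.rpow_one]
  have e3 : ∀ x, (k x ^ (1 / τ)) ^ τ = k x := by
    intro x
    rw [← ENNReal.rpow_mul, one_div_mul_cancel hτ0.ne', ENNReal.rpow_one]
  simp only [e1, e2, e3] at h1
  calc (∫⁻ x, k x * f x ∂μ) ^ σ
      ≤ ((∫⁻ x, k x * f x ^ σ ∂μ) ^ (1 / σ) * (∫⁻ x, k x ∂μ) ^ (1 / τ)) ^ σ := by gcongr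
    _ = _ := by
        rw [ENNReal.mul_rpow_of_nonneg _ _ hσ0.le, ← ENNReal.rpow_mul, ← ENNReal.rpow_mul,
          one_div_mul_cancel hσ0.ne', ENNReal.rpow_one, mul_comm]
        congr 2
        have := hc.symm.sub_one_mul_conj
        have h2 := hc.inv_add_inv_eq_one
        field_simp at h2 ⊢
        linarith

variable {n : ℕ}

theorem aemeasurable_kernel_mul {k f : Rn n → ℝ≥0∞} (hk : Measurable k) (hf : AEMeasurable f)
    (x : Rn n) : AEMeasurable (fun y => k (x - y) * f y) :=
  (hk.comp (measurable_const.sub measurable_id)).aemeasurable.mul hf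

theorem measurable_conv {k f : Rn n → ℝ≥0∞} (hk : Measurable k) (hf : AEMeasurable f) :
    Measurable (fun x => ∫⁻ y, k (x - y) * f y) := by
  have : (fun x => ∫⁻ y, k (x - y) * f y) = fun x => ∫⁻ y, k (x - y) * hf.mk f y := by
    ext x
    exact lintegral_congr_ae (hf.ae_eq_mk.mono fun y hy => by simp only [hy])
  rw [this]
  have hm := hf.measurable_mk
  refine Measurable.lintegral_prod_right' (f := fun z : Rn n × Rn n => k (z.1 - z.2) * hf.mk f z.2)
    ?_
  exact (hk.comp (measurable_fst.sub measurable_snd)).mul (hm.comp measurable_snd)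

theorem lintegral_conv_mul {k f ψ : Rn n → ℝ≥0∞} (hk : Measurable k) (hf : AEMeasurable f)
    (hψ : AEMeasurable ψ) :
    ∫⁻ x, (∫⁻ y, k (x - y) * f y) * ψ x = ∫⁻ y, f y * ∫⁻ x, k (x - y) * ψ x := by
  calc ∫⁻ x, (∫⁻ y, k (x - y) * f y) * ψ x
      = ∫⁻ x, ∫⁻ y, k (x - y) * f y * ψ x := by
        refine lintegral_congr fun x => ?_
        rw [lintegral_mul_const'' _ (aemeasurable_kernel_mul hk hf x)]
    _ = ∫⁻ y, ∫⁻ x, k (x - y) * f y * ψ x := by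
        refine lintegral_lintegral_swap ?_
        have h1 : Measurable fun z : Rn n × Rn n => k (z.1 - z.2) :=
          hk.comp (measurable_fst.sub measurable_snd)
        exact (h1.aemeasurable.mul hf.comp_snd).mul hψ.comp_fst
    _ = _ := by
        refine lintegral_congr fun y => ?_
        have h1 : Measurable fun x : Rn n => k (x - y) :=
          hk.comp (measurable_id.sub measurable_const)
        rw [← lintegral_const_mul'' (f := fun x => k (x - y) * ψ x) _ (h1.aemeasurable.mul hψ)]
        exact lintegral_congr fun x => by ring

/-- Young's inequality `L¹ * L^σ ⊆ L^σ`. -/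
theorem lintegral_conv_rpow_le {k f : Rn n → ℝ≥0∞} (hk : Measurable k) (hf : AEMeasurable f)
    {σ : ℝ} (hσ : 1 ≤ σ) :
    ∫⁻ x, (∫⁻ y, k (x - y) * f y) ^ σ ≤ (∫⁻ z, k z) ^ σ * ∫⁻ y, f y ^ σ := by
  have hkx : ∀ x : Rn n, ∫⁻ y, k (x - y) = ∫⁻ z, k z := fun x => lintegral_sub_left_eq_self k x
  have hky : ∀ y : Rn n, ∫⁻ x, k (x - y) = ∫⁻ z, k z := fun y => lintegral_sub_right_eq_self k y
  calc ∫⁻ x, (∫⁻ y, k (x - y) * f y) ^ σ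
      ≤ ∫⁻ x, (∫⁻ z, k z) ^ (σ - 1) * ∫⁻ y, k (x - y) * f y ^ σ := by
        refine lintegral_mono fun x => ?_
        have := lintegral_mul_rpow_le volume (k := fun y => k (x - y)) (f := f)
          (hk.comp (measurable_const.sub measurable_id)).aemeasurable hf hσ
        rwa [hkx] at this
    _ = (∫⁻ z, k z) ^ (σ - 1) * ∫⁻ x, (∫⁻ y, k (x - y) * f y ^ σ) * 1 := by
        simp only [mul_one]
        rw [lintegral_const_mul _ (measurable_conv hk (hf.pow_const σ))]
    _ = (∫⁻ z, k z) ^ (σ - 1) * ((∫⁻ z, k z) * ∫⁻ y, f y ^ σ) := by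
        rw [lintegral_conv_mul hk (hf.pow_const σ) aemeasurable_const]
        simp only [mul_one, hky]
        rw [lintegral_mul_const'' _ (hf.pow_const σ), mul_comm (∫⁻ y, f y ^ σ)]
    _ = _ := by
        rw [← mul_assoc]
        congr 1
        nth_rewrite 2 [← ENNReal.rpow_one (∫⁻ z, k z)]
        rw [← ENNReal.rpow_add_of_nonneg _ _ (by linarith) zero_le_one, sub_add_cancel]

/-! ### The Riesz kernel -/

/-- The function `|z| ^ (α - n)`. -/
noncomputable def kernel (n : ℕ) (α : ℝ) (z : Rn n) : ℝ≥0∞ := ‖z‖ₑ ^ (α - (n : ℝ))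

/-- The part of the Riesz kernel in the unit ball. -/
noncomputable def kernelNear (n : ℕ) (α : ℝ) : Rn n → ℝ≥0∞ :=
  (Metric.ball 0 1).indicator (kernel n α)

/-- The part of the Riesz kernel outside of the unit ball. -/
noncomputable def kernelFar (n : ℕ) (α : ℝ) : Rn n → ℝ≥0∞ :=
  (Metric.ball 0 1)ᶜ.indicator (kernel n α)

variable {α s : ℝ}

theorem measurable_kernel : Measurable (kernel n α) := by
  unfold kernel; fun_prop

theorem measurable_kernelNear : Measurable (kernelNear n α) :=
  measurable_kernel.indicator measurableSet_ball

theorem measurable_kernelFar : Measurable (kernelFar n α) :=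
  measurable_kernel.indicator measurableSet_ball.compl

theorem kernelNear_add_kernelFar (z : Rn n) : kernelNear n α z + kernelFar n α z = kernel n α z :=
  congrFun (Set.indicator_self_add_compl _ _) z

theorem kernel_neg (z : Rn n) : kernel n α (-z) = kernel n α z := by simp [kernel]

theorem kernel_sub_comm (x y : Rn n) : kernel n α (x - y) = kernel n α (y - x) := by
  rw [← kernel_neg, neg_sub]

theorem kernel_eq_ofReal {z : Rn n} (hz : z ≠ 0) :
    kernel n α z = ENNReal.ofReal (‖z‖ ^ (α - (n : ℝ))) := by
  rw [kernel, ← ofReal_norm, ENNReal.ofReal_rpow_of_pos (norm_pos_iff.2 hz)]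

theorem lintegral_kernelNear_lt_top (hn : 1 ≤ n) (hα : 0 < α) :
    ∫⁻ z, kernelNear n α z < ∞ := by
  have hfin : Module.finrank ℝ (Rn n) = n := by simp
  have h := integrableOn_ball_of_norm_le_rpow (E := Rn n) (μ := volume) (by rw [hfin]; exact hn)
    (f := fun z : Rn n => ‖z‖ ^ (α - (n : ℝ))) (C := 1) (α := n - α) (r := 1)
    (by rw [hfin]; linarith)
    (by
      refine Filter.Eventually.of_forall fun x => ?_
      rw [neg_sub, one_mul, Real.norm_of_nonneg (by positivity)])
    (measurable_norm.pow_const _).aestronglyMeasurable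
  have h2 := h.2
  rw [hasFiniteIntegral_iff_enorm] at h2
  rw [kernelNear, lintegral_indicator measurableSet_ball]
  refine lt_of_le_of_lt (le_of_eq (lintegral_congr_ae ?_)) h2
  have : Nontrivial (Rn n) := by
    apply Module.nontrivial_of_finrank_pos (R := ℝ); rw [hfin]; exact hn
  filter_upwards [ae_restrict_of_ae (Measure.ae_ne volume (0 : Rn n))] with z hz
  rw [kernel_eq_ofReal hz, Real.enorm_of_nonneg (by positivity)]

theorem lintegral_kernelFar_rpow_lt_top {σ : ℝ} (hσ0 : 0 < σ) (hσ : (n : ℝ) < (n - α) * σ) :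
    ∫⁻ z, kernelFar n α z ^ σ < ∞ := by
  set b := (n - α) * σ with hb
  have hb0 : 0 < b := lt_of_le_of_lt (Nat.cast_nonneg n) hσ
  have h := finite_integral_one_add_norm (E := Rn n) (μ := volume) (r := b) (by simpa using hσ)
  have h2 : ∫⁻ z, kernelFar n α z ^ σ ≤
      ∫⁻ z : Rn n, ENNReal.ofReal (2 ^ b) * ENNReal.ofReal ((1 + ‖z‖) ^ (-b)) := by
    refine lintegral_mono fun z => ?_
    by_cases hz : z ∈ Metric.ball (0 : Rn n) 1
    · simp [kernelFar, hz, hσ0]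
    · simp only [kernelFar]
      rw [Set.indicator_of_mem (show z ∈ (Metric.ball (0 : Rn n) 1)ᶜ from hz)]
      have hz1 : 1 ≤ ‖z‖ := by simpa using hz
      rw [kernel_eq_ofReal (norm_pos_iff.1 (by linarith)), ENNReal.ofReal_rpow_of_pos (by positivity),
        ← ENNReal.ofReal_mul (by positivity)]
      apply ENNReal.ofReal_le_ofReal
      rw [← Real.rpow_mul (norm_nonneg _), show (α - n) * σ = -b by rw [hb]; ring]
      -- Outside the unit ball |z| ≥ (1 + |z|)/2; this is the source of the factor 2^b.
      calc ‖z‖ ^ (-b) ≤ ((1 + ‖z‖) / 2) ^ (-b) :=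
            Real.rpow_le_rpow_of_nonpos (by positivity) (by linarith) (by linarith)
        _ = _ := by
            rw [Real.div_rpow (by positivity) (by norm_num), Real.rpow_neg (by norm_num : (0:ℝ) ≤ 2)]
            field_simp
  refine h2.trans_lt ?_
  rw [lintegral_const_mul' _ _ ENNReal.ofReal_ne_top]
  exact ENNReal.mul_lt_top ENNReal.ofReal_lt_top h

/-! ### Basic properties of Riesz potentials -/

theorem rieszPotential_eq (f : Rn n → ℝ≥0∞) (x : Rn n) :
    rieszPotential α f x = ENNReal.ofReal (rieszConst n α) * ∫⁻ y, kernel n α (x - y) * f y := rfl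

theorem rieszConst_pos (hα : 0 < α) (hαn : α < n) : 0 < rieszConst n α := by
  unfold rieszConst
  have h1 : 0 < Real.Gamma (((n : ℝ) - α) / 2) := Real.Gamma_pos_of_pos (by linarith)
  have h2 : 0 < Real.Gamma (α / 2) := Real.Gamma_pos_of_pos (by linarith)
  positivity

theorem rieszPotential_mono_ae {f g : Rn n → ℝ≥0∞} (h : f ≤ᵐ[volume] g) (x : Rn n) :
    rieszPotential α f x ≤ rieszPotential α g x := by
  rw [rieszPotential_eq, rieszPotential_eq]
  refine mul_le_mul_right (lintegral_mono_ae ?_) _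
  filter_upwards [h] with y hy
  gcongr

theorem measurable_rieszPotential {f : Rn n → ℝ≥0∞} (hf : AEMeasurable f) :
    Measurable (rieszPotential α f) :=
  (measurable_conv measurable_kernel hf).const_mul _

theorem rieszPotential_add {f g : Rn n → ℝ≥0∞} (hf : AEMeasurable f) (x : Rn n) :
    rieszPotential α (fun y => f y + g y) x = rieszPotential α f x + rieszPotential α g x := by
  simp only [rieszPotential_eq, mul_add]
  rw [lintegral_add_left' (aemeasurable_kernel_mul measurable_kernel hf x), mul_add]

theorem rieszPotential_const_mul {f : Rn n → ℝ≥0∞} {c : ℝ≥0∞} (hc : c ≠ ∞) (x : Rn n) :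
    rieszPotential α (fun y => c * f y) x = c * rieszPotential α f x := by
  simp only [rieszPotential_eq]
  rw [mul_left_comm, ← lintegral_const_mul' _ _ hc]
  congr 1
  exact lintegral_congr fun y => by ring

theorem lintegral_rieszPotential_mul {f ψ : Rn n → ℝ≥0∞} (hf : AEMeasurable f)
    (hψ : AEMeasurable ψ) :
    ∫⁻ x, rieszPotential α f x * ψ x = ∫⁻ y, f y * rieszPotential α ψ y := by
  simp only [rieszPotential_eq, mul_assoc]
  rw [lintegral_const_mul' _ _ ENNReal.ofReal_ne_top, lintegral_conv_mul measurable_kernel hf hψ,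
    ← lintegral_const_mul' _ _ ENNReal.ofReal_ne_top]
  refine lintegral_congr fun y => ?_
  rw [mul_left_comm]
  simp only [kernel_sub_comm]

theorem rieszPotential_eq_near_add_far {f : Rn n → ℝ≥0∞} (hf : AEMeasurable f) (x : Rn n) :
    rieszPotential α f x = ENNReal.ofReal (rieszConst n α) *
      ((∫⁻ y, kernelNear n α (x - y) * f y) + ∫⁻ y, kernelFar n α (x - y) * f y) := by
  rw [rieszPotential_eq, ← lintegral_add_left' (aemeasurable_kernel_mul measurable_kernelNear hf x)]
  simp only [← add_mul, kernelNear_add_kernelFar]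

/-! ### Integrability of Riesz potentials -/

/-- The condition α < n/s enters here: it places the far part of the kernel in L^{s'}. -/
theorem natCast_lt_sub_mul_conjExponent (hs : 1 < s) (hαn : α < (n : ℝ) / s) :
    (n : ℝ) < (n - α) * s.conjExponent := by
  rw [Real.conjExponent]
  rw [lt_div_iff₀ (by linarith)] at hαn
  rw [← mul_div_assoc, lt_div_iff₀ (by linarith)]
  nlinarith

theorem one_le_of_lt_div (hα : 0 < α) (hαn : α < (n : ℝ) / s) : 1 ≤ n := by
  rcases Nat.eq_zero_or_pos n with rfl | h
  · simp at hαn; linarith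
  · exact h

theorem lt_natCast_of_lt_div (hs : 1 < s) (hαn : α < (n : ℝ) / s) : α < n :=
  hαn.trans_le (div_le_self (Nat.cast_nonneg n) hs.le)

/-- The `s`-th power of the Riesz potential of an `L^s` function is locally integrable. -/
theorem setLIntegral_rieszPotential_rpow_lt_top (hs : 1 < s) (hα : 0 < α) (hαn : α < (n : ℝ) / s)
    {h : Rn n → ℝ≥0∞} (hh : AEMeasurable h) (hhs : ∫⁻ x, h x ^ s < ∞) {K : Set (Rn n)}
    (hK : IsCompact K) : ∫⁻ x in K, rieszPotential α h x ^ s < ∞ := by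
  have hs0 : 0 < s := by linarith
  have hc := Real.HolderConjugate.conjExponent hs
  set c0 := ENNReal.ofReal (rieszConst n α)
  set D := (∫⁻ z, kernelFar n α z ^ s.conjExponent) ^ (1 / s.conjExponent) *
    (∫⁻ x, h x ^ s) ^ (1 / s)
  have hD : D < ∞ := ENNReal.mul_lt_top
    (ENNReal.rpow_lt_top_of_nonneg (by have := hc.symm.pos; positivity)
      (lintegral_kernelFar_rpow_lt_top hc.symm.pos
        (natCast_lt_sub_mul_conjExponent hs hαn)).ne)
    (ENNReal.rpow_lt_top_of_nonneg (by positivity) hhs.ne)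
  -- The far part is bounded uniformly in x by Hölder; the near part is handled below by Young's
  -- inequality.
  have hfar : ∀ x, ∫⁻ y, kernelFar n α (x - y) * h y ≤ D := by
    intro x
    have h1 : Measurable fun y => kernelFar n α (x - y) :=
      measurable_kernelFar.comp (measurable_const.sub measurable_id)
    have := ENNReal.lintegral_mul_le_Lp_mul_Lq volume hc.symm h1.aemeasurable hh
    rw [lintegral_sub_left_eq_self (fun z => kernelFar n α z ^ s.conjExponent) x] at this
    exact this
  have hpt : ∀ x, rieszPotential α h x ^ s ≤
      c0 ^ s * (2 ^ (s - 1) * ((∫⁻ y, kernelNear n α (x - y) * h y) ^ s + D ^ s)) := by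
    intro x
    rw [rieszPotential_eq_near_add_far hh, ENNReal.mul_rpow_of_nonneg _ _ hs0.le]
    gcongr
    refine (ENNReal.rpow_add_le_mul_rpow_add_rpow _ _ hs.le).trans ?_
    gcongr
    exact hfar x
  have hc0 : c0 ^ s ≠ ∞ := (ENNReal.rpow_lt_top_of_nonneg hs0.le ENNReal.ofReal_ne_top).ne
  have h2 : (2 : ℝ≥0∞) ^ (s - 1) ≠ ∞ :=
    (ENNReal.rpow_lt_top_of_nonneg (by linarith) (by simp)).ne
  refine (lintegral_mono hpt).trans_lt ?_
  rw [lintegral_const_mul' _ _ hc0, lintegral_const_mul' _ _ h2,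
    lintegral_add_right _ measurable_const, lintegral_const]
  refine ENNReal.mul_lt_top hc0.lt_top (ENNReal.mul_lt_top h2.lt_top (ENNReal.add_lt_top.2 ⟨?_, ?_⟩))
  · refine (setLIntegral_le_lintegral _ _).trans_lt ?_
    refine (lintegral_conv_rpow_le measurable_kernelNear hh hs.le).trans_lt ?_
    exact ENNReal.mul_lt_top (ENNReal.rpow_lt_top_of_nonneg hs0.le
      (lintegral_kernelNear_lt_top (one_le_of_lt_div hα hαn) hα).ne) hhs
  · refine ENNReal.mul_lt_top (ENNReal.rpow_lt_top_of_nonneg hs0.le hD.ne) ?_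
    simpa using hK.measure_lt_top

/-- An integrable positive weight bounded by `1`. -/
noncomputable def refWeight (n : ℕ) (x : Rn n) : ℝ≥0∞ :=
  ENNReal.ofReal ((1 + ‖x‖) ^ (-((n : ℝ) + 1)))

theorem measurable_refWeight : Measurable (refWeight n) := by
  unfold refWeight; fun_prop

theorem refWeight_pos (x : Rn n) : 0 < refWeight n x := by
  rw [refWeight, ENNReal.ofReal_pos]; positivity

theorem refWeight_le_one (x : Rn n) : refWeight n x ≤ 1 := by
  rw [refWeight, ENNReal.ofReal_le_one]
  exact Real.rpow_le_one_of_one_le_of_nonpos (by linarith [norm_nonneg x])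
    (by have := Nat.cast_nonneg (α := ℝ) n; linarith)

theorem lintegral_refWeight_lt_top : ∫⁻ x, refWeight n x < ∞ :=
  finite_integral_one_add_norm (by simp)

/-- Young's inequality is used twice with the roles exchanged: the near kernel is in L¹ and the
weight in L^{s'}, whereas the far kernel is in L^{s'} and the weight in L¹. By symmetry of the
kernel, this bound controls potentials of L^s functions in a weighted L¹ space. -/
theorem lintegral_rieszPotential_refWeight_lt_top (hs : 1 < s) (hα : 0 < α)
    (hαn : α < (n : ℝ) / s) :
    ∫⁻ x, rieszPotential α (refWeight n) x ^ s.conjExponent < ∞ := by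
  have hc := Real.HolderConjugate.conjExponent hs
  set τ := s.conjExponent
  have hτ0 : 0 < τ := hc.symm.pos
  have hτ1 : 1 < τ := hc.symm.lt
  set c0 := ENNReal.ofReal (rieszConst n α)
  have hw := measurable_refWeight (n := n)
  have hwτ : ∫⁻ x, refWeight n x ^ τ < ∞ := by
    refine (lintegral_mono fun x => ?_).trans_lt (lintegral_refWeight_lt_top (n := n))
    exact ENNReal.rpow_le_self_of_le_one (refWeight_le_one x) hτ1.le
  have hpt : ∀ x, rieszPotential α (refWeight n) x ^ τ ≤
      c0 ^ τ * (2 ^ (τ - 1) * ((∫⁻ y, kernelNear n α (x - y) * refWeight n y) ^ τ +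
        (∫⁻ y, refWeight n (x - y) * kernelFar n α y) ^ τ)) := by
    intro x
    rw [rieszPotential_eq_near_add_far hw.aemeasurable, ENNReal.mul_rpow_of_nonneg _ _ hτ0.le]
    gcongr
    refine (ENNReal.rpow_add_le_mul_rpow_add_rpow _ _ hτ1.le).trans (le_of_eq ?_)
    rw [← lintegral_sub_left_eq_self (fun y => kernelFar n α (x - y) * refWeight n y) x]
    simp only [sub_sub_cancel, mul_comm]
  have hc0 : c0 ^ τ ≠ ∞ := (ENNReal.rpow_lt_top_of_nonneg hτ0.le ENNReal.ofReal_ne_top).ne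
  have h2 : (2 : ℝ≥0∞) ^ (τ - 1) ≠ ∞ :=
    (ENNReal.rpow_lt_top_of_nonneg (by linarith) (by simp)).ne
  refine (lintegral_mono hpt).trans_lt ?_
  rw [lintegral_const_mul' _ _ hc0, lintegral_const_mul' _ _ h2, lintegral_add_left
    ((measurable_conv measurable_kernelNear hw.aemeasurable).pow_const _)]
  refine ENNReal.mul_lt_top hc0.lt_top (ENNReal.mul_lt_top h2.lt_top (ENNReal.add_lt_top.2 ⟨?_, ?_⟩))
  · refine (lintegral_conv_rpow_le measurable_kernelNear hw.aemeasurable hτ1.le).trans_lt ?_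
    exact ENNReal.mul_lt_top (ENNReal.rpow_lt_top_of_nonneg hτ0.le
      (lintegral_kernelNear_lt_top (one_le_of_lt_div hα hαn) hα).ne) hwτ
  · refine (lintegral_conv_rpow_le hw measurable_kernelFar.aemeasurable hτ1.le).trans_lt ?_
    exact ENNReal.mul_lt_top (ENNReal.rpow_lt_top_of_nonneg hτ0.le lintegral_refWeight_lt_top.ne)
      (lintegral_kernelFar_rpow_lt_top hτ0 (natCast_lt_sub_mul_conjExponent hs hαn))

/-- The Riesz potential is bounded from `L^s` to a weighted `L¹`. -/
theorem lintegral_rieszPotential_mul_refWeight_le (hs : 1 < s) {f : Rn n → ℝ≥0∞}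
    (hf : AEMeasurable f) :
    ∫⁻ x, rieszPotential α f x * refWeight n x ≤ (∫⁻ x, f x ^ s) ^ (1 / s) *
      (∫⁻ x, rieszPotential α (refWeight n) x ^ s.conjExponent) ^ (1 / s.conjExponent) := by
  rw [lintegral_rieszPotential_mul hf measurable_refWeight.aemeasurable]
  exact ENNReal.lintegral_mul_le_Lp_mul_Lq volume (Real.HolderConjugate.conjExponent hs) hf
    (measurable_rieszPotential measurable_refWeight.aemeasurable).aemeasurable

theorem ae_of_ae_mul_refWeight {P : Rn n → Prop}
    (h : ∀ᵐ x ∂(volume.withDensity (refWeight n)), P x) : ∀ᵐ x : Rn n, P x := by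
  rw [ae_withDensity_iff measurable_refWeight] at h
  exact h.mono fun x hx => hx (refWeight_pos x).ne'

/-- The indicator of a ball of radius R around K works: |x - y| ≤ 2R there, and the kernel exponent
is negative. -/
theorem exists_rieszPotential_ge (hα : 0 < α) (hαn : α < n) (hs : 0 < s) {K : Set (Rn n)}
    (hK : IsCompact K) : ∃ h : Rn n → ℝ≥0∞, Measurable h ∧ ∫⁻ x, h x ^ s < ∞ ∧
      ∃ c : ℝ≥0∞, 0 < c ∧ ∀ x ∈ K, c ≤ rieszPotential α h x := by
  obtain ⟨R, hR, hKR⟩ := hK.isBounded.exists_pos_norm_le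
  have hvol0 : 0 < volume (Metric.closedBall (0 : Rn n) R) :=
    Metric.measure_closedBall_pos _ _ hR
  have hvol : volume (Metric.closedBall (0 : Rn n) R) < ∞ := measure_closedBall_lt_top
  refine ⟨(Metric.closedBall 0 R).indicator 1, measurable_one.indicator measurableSet_closedBall,
    ?_, ENNReal.ofReal (rieszConst n α) *
      (ENNReal.ofReal (2 * R) ^ (α - (n : ℝ)) * volume (Metric.closedBall (0 : Rn n) R)), ?_, ?_⟩
  · have : ∀ x : Rn n, ((Metric.closedBall (0 : Rn n) R).indicator (1 : Rn n → ℝ≥0∞) x) ^ s =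
        (Metric.closedBall (0 : Rn n) R).indicator (fun _ => 1) x := by
      intro x
      by_cases hx : x ∈ Metric.closedBall (0 : Rn n) R <;> simp [Set.indicator, hx, hs]
    simp only [this]
    rw [lintegral_indicator measurableSet_closedBall]
    simpa using hvol
  · refine ENNReal.mul_pos (by simpa using rieszConst_pos hα hαn) (mul_ne_zero ?_ hvol0.ne')
    exact (ENNReal.rpow_pos (by simpa using hR) ENNReal.ofReal_ne_top).ne'
  · intro x hx
    rw [rieszPotential_eq]
    gcongr
    rw [← setLIntegral_const, ← lintegral_indicator measurableSet_closedBall]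
    refine lintegral_mono fun y => ?_
    by_cases hy : y ∈ Metric.closedBall (0 : Rn n) R
    · simp only [Set.indicator_of_mem hy, Pi.one_apply, mul_one, kernel]
      have h1 : ‖x - y‖ₑ ≤ ENNReal.ofReal (2 * R) := by
        rw [← ofReal_norm]
        apply ENNReal.ofReal_le_ofReal
        have := norm_sub_le x y
        have := hKR x hx
        have : ‖y‖ ≤ R := by simpa using hy
        linarith
      exact ennreal_rpow_le_rpow_of_nonpos h1 (by linarith)
    · simp [hy]

end

section

/-! ### Almost everywhere limits of elements of decreasing convex sets -/

/-- The strictly convex function `a ↦ 1 / (1 + a)` on `[0, ∞]`. -/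
noncomputable def recipSucc (a : ℝ≥0∞) : ℝ := ((1 + a)⁻¹).toReal

theorem recipSucc_nonneg (a : ℝ≥0∞) : 0 ≤ recipSucc a := ENNReal.toReal_nonneg

theorem one_add_inv_le_one (a : ℝ≥0∞) : (1 + a)⁻¹ ≤ 1 := by
  rw [ENNReal.inv_le_one]; exact le_self_add

theorem one_add_inv_ne_top (a : ℝ≥0∞) : (1 + a)⁻¹ ≠ ∞ :=
  ne_top_of_le_ne_top ENNReal.one_ne_top (one_add_inv_le_one a)

theorem recipSucc_le_one (a : ℝ≥0∞) : recipSucc a ≤ 1 := by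
  rw [recipSucc]
  exact ENNReal.toReal_le_of_le_ofReal zero_le_one (by simp)

theorem measurable_recipSucc : Measurable recipSucc := by
  unfold recipSucc; fun_prop

theorem inv_ofReal_recipSucc_sub_one (a : ℝ≥0∞) :
    (ENNReal.ofReal (recipSucc a))⁻¹ - 1 = a := by
  rw [recipSucc, ENNReal.ofReal_toReal (one_add_inv_ne_top a), inv_inv]
  exact ENNReal.add_sub_cancel_left ENNReal.one_ne_top

theorem recipSucc_top : recipSucc ∞ = 0 := by simp [recipSucc]

theorem recipSucc_coe (a : ℝ≥0) : recipSucc a = (1 + (a : ℝ))⁻¹ := by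
  rw [recipSucc, ENNReal.toReal_inv, ENNReal.toReal_add (by simp) (by simp)]
  simp

/-- Uniform convexity measured in the bounded coordinate 1/(1+a). With A = 1 + a and B = 1 + b the
convexity gap equals (1/A - 1/B)² / (2(1/A + 1/B)), and 1/A + 1/B ≤ 2. -/
theorem recipSucc_midpoint (a b : ℝ≥0∞) :
    (recipSucc a - recipSucc b) ^ 2 / 4 + recipSucc ((a + b) / 2) ≤
      (recipSucc a + recipSucc b) / 2 := by
  have ha := recipSucc_nonneg a
  have ha1 := recipSucc_le_one a
  have hb := recipSucc_nonneg b
  have hb1 := recipSucc_le_one b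
  by_cases hat : a = ∞
  · subst hat
    simp only [top_add, ENNReal.top_div_of_ne_top (ENNReal.ofNat_ne_top (n := 2)), recipSucc_top]
    nlinarith
  by_cases hbt : b = ∞
  · subst hbt
    simp only [add_top, ENNReal.top_div_of_ne_top (ENNReal.ofNat_ne_top (n := 2)), recipSucc_top]
    nlinarith
  lift a to ℝ≥0 using hat
  lift b to ℝ≥0 using hbt
  have hmid : ((a : ℝ≥0∞) + b) / 2 = (((a + b) / 2 : ℝ≥0) : ℝ≥0∞) := by
    rw [ENNReal.coe_div two_ne_zero]; simp
  rw [hmid]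
  simp only [recipSucc_coe] at *
  push_cast
  have hA : (0 : ℝ) < 1 + a := by positivity
  have hB : (0 : ℝ) < 1 + b := by positivity
  have hm : (1 + ((a : ℝ) + b) / 2) = ((1 + a) + (1 + b)) / 2 := by ring
  rw [hm]
  set A : ℝ := 1 + a
  set B : ℝ := 1 + b
  have key : (A⁻¹ + B⁻¹) / 2 - ((A + B) / 2)⁻¹ = (A⁻¹ - B⁻¹) ^ 2 / (2 * (A⁻¹ + B⁻¹)) := by
    field_simp
    ring
  have hpos : 0 < A⁻¹ + B⁻¹ := by positivity
  have : (A⁻¹ - B⁻¹) ^ 2 / 4 ≤ (A⁻¹ - B⁻¹) ^ 2 / (2 * (A⁻¹ + B⁻¹)) :=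
    div_le_div_of_nonneg_left (sq_nonneg _) (by positivity) (by linarith)
  linarith

/-- A parallelogram argument for Ψ(h) = ∫ 1/(1+h): two almost minimizers whose midpoint still
competes must be close in the coordinate 1/(1+h), in L²(ν). No bound on the functions is needed,
since that coordinate takes values in [0, 1] and the limit may be infinite. -/
theorem exists_ae_tendsto_of_midpoint_mem {X : Type*} [MeasurableSpace X] (ν : Measure X)
    [IsFiniteMeasure ν] {C : ℕ → Set (X → ℝ≥0∞)} (anti : Antitone C) (hne : ∀ m, (C m).Nonempty)
    (hmeas : ∀ m, ∀ h ∈ C m, AEMeasurable h ν)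
    (hmid : ∀ m, ∀ f ∈ C m, ∀ g ∈ C m, (fun x => (f x + g x) / 2) ∈ C m) :
    ∃ (h : ℕ → X → ℝ≥0∞) (h₀ : X → ℝ≥0∞), (∀ m, h m ∈ C m) ∧
      ∀ᵐ x ∂ν, Tendsto (fun m => h m x) atTop (𝓝 (h₀ x)) := by
  let Ψ : (X → ℝ≥0∞) → ℝ := fun h => ∫ x, recipSucc (h x) ∂ν
  have hsm : ∀ h : X → ℝ≥0∞, AEMeasurable h ν →
      AEStronglyMeasurable (fun x => recipSucc (h x)) ν := fun h hh =>
    (measurable_recipSucc.comp_aemeasurable hh).aestronglyMeasurable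
  have hint : ∀ h : X → ℝ≥0∞, AEMeasurable h ν → Integrable (fun x => recipSucc (h x)) ν :=
    fun h hh => Integrable.of_bound (hsm h hh) 1 (Eventually.of_forall fun x => by
      rw [Real.norm_of_nonneg (recipSucc_nonneg _)]; exact recipSucc_le_one _)
  have hΨ0 : ∀ h, 0 ≤ Ψ h := fun h => integral_nonneg fun x => recipSucc_nonneg _
  have hbdd : ∀ m, BddBelow (Ψ '' C m) := fun m => ⟨0, by rintro _ ⟨h, -, rfl⟩; exact hΨ0 h⟩
  let d : ℕ → ℝ := fun m => sInf (Ψ '' C m)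
  have hdmono : Monotone d := fun i j hij =>
    csInf_le_csInf (hbdd i) ((hne j).image _) (Set.image_mono (anti hij))
  have hdle : ∀ m, ∀ h ∈ C m, d m ≤ Ψ h := fun m h hh => csInf_le (hbdd m) ⟨h, hh, rfl⟩
  have hdbdd : BddAbove (Set.range d) := by
    refine ⟨ν.real Set.univ, ?_⟩
    rintro _ ⟨m, rfl⟩
    obtain ⟨h, hh⟩ := hne m
    refine (hdle m h hh).trans ?_
    calc Ψ h ≤ ∫ _, (1 : ℝ) ∂ν :=
          integral_mono (hint h (hmeas m h hh)) (integrable_const _) fun x => recipSucc_le_one _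
      _ = _ := by simp
  let D := ⨆ m, d m
  have hdD : ∀ m, d m ≤ D := le_ciSup hdbdd
  have hex : ∀ m : ℕ, ∃ h ∈ C m, Ψ h < d m + 1 / ((m : ℝ) + 1) := by
    intro m
    obtain ⟨_, ⟨h, hh, rfl⟩, hlt⟩ := Real.lt_sInf_add_pos ((hne m).image Ψ)
      (show (0 : ℝ) < 1 / ((m : ℝ) + 1) by positivity)
    exact ⟨h, hh, hlt⟩
  choose h hhC hhΨ using hex
  have hhm : ∀ m, AEMeasurable (h m) ν := fun m => hmeas m _ (hhC m)
  -- For j, k ≥ N the average of Ψ(h_j) and Ψ(h_k) is at most D + 1/(N+1), while the midpoint lies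
  -- in C_N and has Ψ ≥ d_N; the 4 comes from `recipSucc_midpoint`.
  let δ : ℕ → ℝ := fun N => 4 * (D - d N + 1 / ((N : ℝ) + 1))
  have hδ : ∀ N j k, N ≤ j → N ≤ k →
      ∫ x, (recipSucc (h j x) - recipSucc (h k x)) ^ 2 ∂ν ≤ δ N := by
    intro N j k hj hk
    have hmem := hmid N _ (anti hj (hhC j)) _ (anti hk (hhC k))
    have h1 := hdle N _ hmem
    have hI := hint _ (hmeas N _ hmem)
    have hsq : Integrable (fun x => (recipSucc (h j x) - recipSucc (h k x)) ^ 2 / 4) ν := by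
      refine Integrable.div_const ?_ 4
      refine Integrable.of_bound (((hsm _ (hhm j)).sub (hsm _ (hhm k))).pow 2) 1
        (Eventually.of_forall fun x => ?_)
      rw [Real.norm_of_nonneg (sq_nonneg _)]
      have := recipSucc_nonneg (h j x)
      have := recipSucc_nonneg (h k x)
      have := recipSucc_le_one (h j x)
      have := recipSucc_le_one (h k x)
      rw [sq_le_one_iff_abs_le_one, abs_le]
      constructor <;> linarith
    have h2 := integral_mono (hsq.add hI)
      (((hint _ (hhm j)).add (hint _ (hhm k))).div_const 2)
      fun x => recipSucc_midpoint (h j x) (h k x)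
    rw [integral_add' hsq hI, integral_div, integral_div,
      integral_add' (hint _ (hhm j)) (hint _ (hhm k))] at h2
    have hj2 := hhΨ j
    have hk2 := hhΨ k
    have ej : 1 / ((j : ℝ) + 1) ≤ 1 / ((N : ℝ) + 1) := by gcongr
    have ek : 1 / ((k : ℝ) + 1) ≤ 1 / ((N : ℝ) + 1) := by gcongr
    have := hdD j
    have := hdD k
    simp only [Ψ] at hj2 hk2 h1
    simp only [δ]
    linarith
  have hδ0 : Tendsto δ atTop (𝓝 0) := by
    have h1 : Tendsto d atTop (𝓝 D) := tendsto_atTop_ciSup hdmono hdbdd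
    have h2 := ((tendsto_const_nhds (x := D)).sub h1).add
      (tendsto_one_div_add_atTop_nhds_zero_nat (𝕜 := ℝ))
    have := h2.const_mul 4
    simpa [δ] using this
  -- Successive L² distances below 2^{-j} are summable, which gives a.e. convergence.
  obtain ⟨φ, hφ, hφδ⟩ := extraction_forall_of_eventually'
    (P := fun (j m : ℕ) => δ m < ((1 / 2 : ℝ) ^ j) ^ 2) fun j => by
      have := (hδ0.eventually (gt_mem_nhds (show (0 : ℝ) < ((1 / 2 : ℝ) ^ j) ^ 2 by positivity)))
      exact eventually_atTop.1 this
  have hcau := Lp.ae_tendsto_of_cauchy_eLpNorm (μ := ν) (p := 2)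
    (f := fun j x => recipSucc (h (φ j) x)) (fun j => hsm _ (hhm _)) (by norm_num)
    (B := fun j => ENNReal.ofReal ((1 / 2 : ℝ) ^ j))
    (by
      rw [← ENNReal.ofReal_tsum_of_nonneg (fun j => by positivity) summable_geometric_two]
      exact ENNReal.ofReal_ne_top)
    (by
      intro N j k hj hk
      have hml : MemLp ((fun x => recipSucc (h (φ j) x)) - fun x => recipSucc (h (φ k) x)) 2 ν := by
        refine MemLp.of_bound ((hsm _ (hhm _)).sub (hsm _ (hhm _))) 1
          (Eventually.of_forall fun x => ?_)
        have := recipSucc_nonneg (h (φ j) x)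
        have := recipSucc_nonneg (h (φ k) x)
        have := recipSucc_le_one (h (φ j) x)
        have := recipSucc_le_one (h (φ k) x)
        rw [Real.norm_eq_abs, abs_le]
        simp only [Pi.sub_apply]
        constructor <;> linarith
      rw [hml.eLpNorm_eq_integral_rpow_norm (by norm_num) (by norm_num)]
      rw [ENNReal.ofReal_lt_ofReal_iff (by positivity)]
      have h1 := (hδ (φ N) (φ j) (φ k) (hφ.monotone hj) (hφ.monotone hk)).trans_lt (hφδ N)
      have h2 : ∀ x, ‖((fun x => recipSucc (h (φ j) x)) - fun x => recipSucc (h (φ k) x)) x‖ ^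
          (2 : ℝ≥0∞).toReal = (recipSucc (h (φ j) x) - recipSucc (h (φ k) x)) ^ 2 := by
        intro x
        simp
      simp only [h2]
      rw [Real.rpow_inv_lt_iff_of_pos (integral_nonneg fun x => sq_nonneg _) (by positivity)
        (by norm_num)]
      simpa using h1)
  refine ⟨fun j => h (φ j), fun x => liminf (fun j => h (φ j) x) atTop,
    fun m => anti (hφ.id_le m) (hhC _), ?_⟩
  filter_upwards [hcau] with x ⟨l, hl⟩
  -- The coordinate is inverted continuously on [0, ∞]; l = 0 corresponds to the limit ∞.
  have h1 : Tendsto (fun j => h (φ j) x) atTop (𝓝 ((ENNReal.ofReal l)⁻¹ - 1)) := by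
    have h2 := (ENNReal.tendsto_ofReal hl).inv
    have h3 := ENNReal.Tendsto.sub h2 (tendsto_const_nhds (x := (1 : ℝ≥0∞)))
      (Or.inr ENNReal.one_ne_top)
    simpa only [inv_ofReal_recipSucc_sub_one] using h3
  rwa [h1.liminf_eq]

end

section

/-! ### Weak convergence of bounded, almost everywhere convergent sequences -/

/-- Where u exceeds T k^{s'-1}, one has k ≤ (u/T)^{s-1}, so u k ≤ T^{1-s} u^s. This splits u k into
a part dominated by T k^{s'} and a part that is small in L¹ for large T when u is bounded in L^s. -/
theorem mul_le_min_mul_add {s : ℝ} (hs : 1 < s) (u k : ℝ≥0∞) {T : ℝ≥0∞} (hT0 : T ≠ 0)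
    (hT : T ≠ ∞) :
    u * k ≤ min u (T * k ^ (s.conjExponent - 1)) * k + T ^ (1 - s) * u ^ s := by
  have hc := Real.HolderConjugate.conjExponent hs
  set τ := s.conjExponent
  have hτ : 0 < τ - 1 := by linarith [hc.symm.lt]
  rcases le_total u (T * k ^ (τ - 1)) with h | h
  · rw [min_eq_left h]; exact le_self_add
  · refine le_add_left ?_
    have h1 : k ^ (τ - 1) ≤ T⁻¹ * u := by
      rw [mul_comm] at h
      rw [← ENNReal.div_eq_inv_mul]
      exact (ENNReal.le_div_iff_mul_le (Or.inl hT0) (Or.inl hT)).2 h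
    have e : (τ - 1) * (s - 1) = 1 := by
      have := hc.sub_one_mul_conj
      have := hc.symm.sub_one_mul_conj
      nlinarith
    have h2 : k ≤ (T⁻¹ * u) ^ (s - 1) := by
      calc k = (k ^ (τ - 1)) ^ (s - 1) := by rw [← ENNReal.rpow_mul, e, ENNReal.rpow_one]
        _ ≤ _ := ENNReal.rpow_le_rpow h1 (by linarith)
    calc u * k ≤ u * (T⁻¹ * u) ^ (s - 1) := by gcongr
      _ = u * (T ^ (1 - s) * u ^ (s - 1)) := by
          rw [ENNReal.mul_rpow_of_nonneg _ _ (by linarith), ENNReal.inv_rpow, ← ENNReal.rpow_neg,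
            neg_sub]
      _ = T ^ (1 - s) * (u ^ (1 : ℝ) * u ^ (s - 1)) := by rw [ENNReal.rpow_one]; ring
      _ = _ := by
          rw [← ENNReal.rpow_add_of_nonneg _ _ zero_le_one (by linarith)]; congr 2; ring

theorem tendsto_lintegral_mul_of_ae_tendsto_zero {X : Type*} [MeasurableSpace X] {μ : Measure X}
    {s : ℝ} (hs : 1 < s) {u : ℕ → X → ℝ≥0∞} {k : X → ℝ≥0∞} (hu : ∀ m, AEMeasurable (u m) μ)
    (hus : ∀ m, ∫⁻ x, u m x ^ s ∂μ ≤ 1)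
    (hu0 : ∀ᵐ x ∂μ, Tendsto (fun m => u m x) atTop (𝓝 0)) (hk : AEMeasurable k μ)
    (hks : ∫⁻ x, k x ^ s.conjExponent ∂μ < ∞) :
    Tendsto (fun m => ∫⁻ x, u m x * k x ∂μ) atTop (𝓝 0) := by
  have hc := Real.HolderConjugate.conjExponent hs
  have hτ0 := hc.symm.pos
  have hτ1 := hc.symm.lt
  have hkfin : ∀ᵐ x ∂μ, k x ≠ ∞ := by
    filter_upwards [ae_lt_top' (hk.pow_const _) hks.ne] with x hx h
    rw [h, ENNReal.top_rpow_of_pos hτ0] at hx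
    exact lt_irrefl _ hx
  rw [ENNReal.tendsto_nhds_zero]
  intro ε hε
  by_cases hεt : ε = ∞
  · simp [hεt]
  have hε2 : ε / 2 ≠ 0 := (ENNReal.half_pos hε.ne').ne'
  have hε2t : ε / 2 ≠ ∞ := (ENNReal.div_lt_top hεt two_ne_zero).ne
  -- Solves T^{1-s} = ε/2, so that the remainder contributes at most ε/2.
  set T : ℝ≥0∞ := (ε / 2) ^ (1 / (1 - s)) with hTdef
  have hT0 : T ≠ 0 := by simp [T, ENNReal.rpow_eq_zero_iff, hε2, hε2t]
  have hT : T ≠ ∞ := by simp [T, ENNReal.rpow_eq_top_iff, hε2, hε2t]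
  have hTs : T ^ (1 - s) = ε / 2 := by
    rw [hTdef, ← ENNReal.rpow_mul, one_div_mul_cancel (by linarith), ENNReal.rpow_one]
  have hminm : ∀ m, AEMeasurable
      (fun x => min (u m x) (T * k x ^ (s.conjExponent - 1)) * k x) μ := fun m =>
    ((hu m).min ((hk.pow_const _).const_mul _)).mul hk
  have hlim : Tendsto (fun m => ∫⁻ x, min (u m x) (T * k x ^ (s.conjExponent - 1)) * k x ∂μ) atTop
      (𝓝 (∫⁻ _, 0 ∂μ)) := by
    refine tendsto_lintegral_of_dominated_convergence' (fun x => T * k x ^ s.conjExponent)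
      hminm ?_ ?_ ?_
    · intro m
      refine Eventually.of_forall fun x => ?_
      calc min (u m x) (T * k x ^ (s.conjExponent - 1)) * k x
          ≤ T * k x ^ (s.conjExponent - 1) * k x := by gcongr; exact min_le_right _ _
        _ = T * (k x ^ (s.conjExponent - 1) * k x ^ (1 : ℝ)) := by rw [ENNReal.rpow_one, mul_assoc]
        _ = _ := by
            rw [← ENNReal.rpow_add_of_nonneg _ _ (by linarith) zero_le_one, sub_add_cancel]
    · rw [lintegral_const_mul' _ _ hT]
      exact (ENNReal.mul_lt_top hT.lt_top hks).ne
    · filter_upwards [hu0, hkfin] with x hx hkx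
      have h1 : Tendsto (fun m => min (u m x) (T * k x ^ (s.conjExponent - 1))) atTop (𝓝 0) :=
        tendsto_of_tendsto_of_tendsto_of_le_of_le tendsto_const_nhds hx (fun _ => zero_le)
          fun _ => min_le_left _ _
      simpa using ENNReal.Tendsto.mul_const h1 (Or.inr hkx)
  rw [lintegral_zero, ENNReal.tendsto_nhds_zero] at hlim
  filter_upwards [hlim (ε / 2) (ENNReal.half_pos hε.ne')] with m hm
  calc ∫⁻ x, u m x * k x ∂μ
      ≤ ∫⁻ x, min (u m x) (T * k x ^ (s.conjExponent - 1)) * k x + T ^ (1 - s) * u m x ^ s ∂μ :=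
        lintegral_mono fun x => mul_le_min_mul_add hs _ _ hT0 hT
    _ = (∫⁻ x, min (u m x) (T * k x ^ (s.conjExponent - 1)) * k x ∂μ) +
        ε / 2 * ∫⁻ x, u m x ^ s ∂μ := by
        rw [lintegral_add_left' (hminm m), hTs, lintegral_const_mul' _ _ hε2t]
    _ ≤ ε / 2 + ε / 2 * 1 := by gcongr; exact hus m
    _ = ε := by rw [mul_one, ENNReal.add_halves]

variable {n : ℕ} {α s : ℝ}

/-- By symmetry ∫ I_α u_m · ψ = ∫ u_m · I_α ψ for the reference weight ψ, and I_α ψ is in L^{s'}.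
Thus the potentials tend to 0 in L¹(ψ dx), and a rapidly convergent subsequence does so a.e. -/
theorem exists_subseq_ae_tendsto_rieszPotential_zero (hs : 1 < s) (hα : 0 < α)
    (hαn : α < (n : ℝ) / s) {u : ℕ → Rn n → ℝ≥0∞} (hu : ∀ m, AEMeasurable (u m))
    (hus : ∀ m, ∫⁻ x, u m x ^ s ≤ 1) (hu0 : ∀ᵐ x, Tendsto (fun m => u m x) atTop (𝓝 0)) :
    ∃ φ : ℕ → ℕ, StrictMono φ ∧
      ∀ᵐ x, Tendsto (fun m => rieszPotential α (u (φ m)) x) atTop (𝓝 0) := by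
  have hψ := measurable_refWeight (n := n)
  have h1 := tendsto_lintegral_mul_of_ae_tendsto_zero hs hu hus hu0
    (measurable_rieszPotential (α := α) hψ.aemeasurable).aemeasurable
    (lintegral_rieszPotential_refWeight_lt_top hs hα hαn)
  simp only [← lintegral_rieszPotential_mul (hu _) hψ.aemeasurable] at h1
  rw [ENNReal.tendsto_nhds_zero] at h1
  obtain ⟨φ, hφ, hφu⟩ := extraction_forall_of_eventually
    (P := fun j m => ∫⁻ x, rieszPotential α (u m) x * refWeight n x ≤ (2⁻¹ : ℝ≥0∞) ^ j)
    fun j => h1 _ (ENNReal.pow_pos (by simp) j)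
  refine ⟨φ, hφ, ?_⟩
  have hm : ∀ j, AEMeasurable (fun x => rieszPotential α (u (φ j)) x * refWeight n x) := fun j =>
    ((measurable_rieszPotential (hu _)).mul hψ).aemeasurable
  have hsum : ∫⁻ x, ∑' j, rieszPotential α (u (φ j)) x * refWeight n x ≠ ∞ := by
    rw [lintegral_tsum hm]
    refine ne_top_of_le_ne_top ?_ (ENNReal.tsum_le_tsum hφu)
    rw [ENNReal.tsum_geometric]
    simp
  filter_upwards [ae_lt_top' (AEMeasurable.tsum hm) hsum] with x hx
  have h2 := ENNReal.tendsto_atTop_zero_of_tsum_ne_top hx.ne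
  have h3 := ENNReal.Tendsto.mul_const (b := (refWeight n x)⁻¹) h2
    (Or.inr (ENNReal.inv_ne_top.2 (refWeight_pos x).ne'))
  rw [zero_mul] at h3
  refine h3.congr fun j => ?_
  rw [mul_assoc, ENNReal.mul_inv_cancel (refWeight_pos x).ne' ENNReal.ofReal_ne_top, mul_one]

/-! ### Attainment of the infimum over the unit ball -/

/-- The nonnegative elements of the unit ball of `L^s`. -/
def lsBall (n : ℕ) (s : ℝ) : Set (Rn n → ℝ≥0∞) := {h | AEMeasurable h ∧ ∫⁻ x, h x ^ s ≤ 1}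

/-- The arithmetic-geometric mean inequality applied twice: to a and b, then to a^{-β} and b^{-β}.
-/
theorem midpoint_rpow_neg_le (a b : ℝ≥0∞) {β : ℝ} (hβ : 0 < β) :
    ((a + b) / 2) ^ (-β) ≤ (a ^ (-β) + b ^ (-β)) / 2 := by
  have hneg : -β < 0 := by linarith
  have amgm : ∀ x y : ℝ≥0∞, x ^ (1 / 2 : ℝ) * y ^ (1 / 2 : ℝ) ≤ (x + y) / 2 := by
    intro x y
    have h := ENNReal.young_inequality (x ^ (1 / 2 : ℝ)) (y ^ (1 / 2 : ℝ))
      Real.HolderConjugate.two_two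
    rw [← ENNReal.rpow_mul, ← ENNReal.rpow_mul] at h
    norm_num at h
    rw [ENNReal.add_div]
    simpa using h
  by_cases ha0 : a = 0
  · simp [ha0, ENNReal.zero_rpow_of_neg hneg, ENNReal.top_div_of_ne_top]
  by_cases hb0 : b = 0
  · simp [hb0, ENNReal.zero_rpow_of_neg hneg, ENNReal.top_div_of_ne_top]
  by_cases hat : a = ∞
  · simp [hat, ENNReal.top_div_of_ne_top, ENNReal.top_rpow_of_neg hneg]
  by_cases hbt : b = ∞
  · simp [hbt, ENNReal.top_div_of_ne_top, ENNReal.top_rpow_of_neg hneg]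
  calc ((a + b) / 2) ^ (-β) ≤ (a ^ (1 / 2 : ℝ) * b ^ (1 / 2 : ℝ)) ^ (-β) :=
        ennreal_rpow_le_rpow_of_nonpos (amgm a b) hneg.le
    _ = (a ^ (-β)) ^ (1 / 2 : ℝ) * (b ^ (-β)) ^ (1 / 2 : ℝ) := by
        rw [ENNReal.mul_rpow_of_ne_top (by simp [ENNReal.rpow_eq_top_iff, hat])
          (by simp [ENNReal.rpow_eq_top_iff, hbt])]
        simp only [← ENNReal.rpow_mul, mul_comm]
    _ ≤ _ := amgm _ _

theorem midpoint_mem_lsBall (hs : 1 ≤ s) {f g : Rn n → ℝ≥0∞} (hf : f ∈ lsBall n s)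
    (hg : g ∈ lsBall n s) : (fun x => (f x + g x) / 2) ∈ lsBall n s := by
  refine ⟨(hf.1.add hg.1).div_const 2, ?_⟩
  calc ∫⁻ x, ((f x + g x) / 2) ^ s ≤ ∫⁻ x, (2⁻¹ * f x ^ s + 2⁻¹ * g x ^ s) := by
        refine lintegral_mono fun x => ?_
        have := ENNReal.rpow_arith_mean_le_arith_mean2_rpow 2⁻¹ 2⁻¹ (f x) (g x)
          ENNReal.inv_two_add_inv_two hs
        rwa [← mul_add, mul_comm, ← div_eq_mul_inv] at this
    _ = 2⁻¹ * (∫⁻ x, f x ^ s) + 2⁻¹ * ∫⁻ x, g x ^ s := by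
        rw [lintegral_add_left' ((hf.1.pow_const s).const_mul _),
          lintegral_const_mul' _ _ (by simp), lintegral_const_mul' _ _ (by simp)]
    _ ≤ 2⁻¹ * 1 + 2⁻¹ * 1 := by gcongr; exacts [hf.2, hg.2]
    _ = 1 := by rw [mul_one, ENNReal.inv_two_add_inv_two]

theorem rieszPotential_midpoint {f g : Rn n → ℝ≥0∞} (hf : AEMeasurable f) (x : Rn n) :
    rieszPotential α (fun y => (f y + g y) / 2) x =
      (rieszPotential α f x + rieszPotential α g x) / 2 := by
  simp only [ENNReal.div_eq_inv_mul]
  rw [rieszPotential_const_mul (by simp), rieszPotential_add hf]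

/-- The competitors for (G_m, c_m) form decreasing convex sets, since G_m increases, c_m decreases
and a ↦ a^{-β} is convex. An a.e. convergent selection has a limit in the ball by Fatou, and the
integral bound passes to the limit by Fatou again. -/
theorem exists_mem_lsBall_lintegral_rpow_neg_le (hs : 1 < s) (hα : 0 < α) (hαn : α < (n : ℝ) / s)
    {β : ℝ} (hβ : 0 < β) {G : ℕ → Rn n → ℝ≥0∞} {G₀ : Rn n → ℝ≥0∞}
    (hG : ∀ m, AEMeasurable (G m)) (hGmono : Monotone G)
    (hGlim : ∀ x, Tendsto (fun m => G m x) atTop (𝓝 (G₀ x))) (hG₀ : ∀ x, G₀ x ≠ ∞)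
    {c : ℕ → ℝ≥0∞} {c₀ : ℝ≥0∞} (hc : Antitone c) (hclim : Tendsto c atTop (𝓝 c₀))
    (hex : ∀ m, ∃ h ∈ lsBall n s, ∫⁻ x, G m x * rieszPotential α h x ^ (-β) ≤ c m) :
    ∃ h ∈ lsBall n s, ∫⁻ x, G₀ x * rieszPotential α h x ^ (-β) ≤ c₀ := by
  have hs0 : 0 < s := by linarith
  let C : ℕ → Set (Rn n → ℝ≥0∞) := fun m =>
    {h | h ∈ lsBall n s ∧ ∫⁻ x, G m x * rieszPotential α h x ^ (-β) ≤ c m}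
  let ν : Measure (Rn n) := volume.withDensity (refWeight n)
  have : IsFiniteMeasure ν := isFiniteMeasure_withDensity lintegral_refWeight_lt_top.ne
  obtain ⟨h, h₀, hhC, hlim⟩ := exists_ae_tendsto_of_midpoint_mem ν (C := C)
    (fun i j hij h hh => ⟨hh.1, ((lintegral_mono fun x => by gcongr; exact hGmono hij x).trans
      hh.2).trans (hc hij)⟩)
    (fun m => by obtain ⟨h, h1, h2⟩ := hex m; exact ⟨h, h1, h2⟩)
    (fun m h hh => hh.1.1.mono_ac (withDensity_absolutelyContinuous _ _))
    (fun m f hf g hg => ⟨midpoint_mem_lsBall hs.le hf.1 hg.1, by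
      have hmf : AEMeasurable fun x => G m x * rieszPotential α f x ^ (-β) :=
        (hG m).mul ((measurable_rieszPotential hf.1.1).pow_const _).aemeasurable
      calc ∫⁻ x, G m x * rieszPotential α (fun y => (f y + g y) / 2) x ^ (-β)
          ≤ ∫⁻ x, 2⁻¹ * (G m x * rieszPotential α f x ^ (-β) +
              G m x * rieszPotential α g x ^ (-β)) := by
            refine lintegral_mono fun x => ?_
            rw [rieszPotential_midpoint hf.1.1, ← mul_add, mul_left_comm, ← ENNReal.div_eq_inv_mul]
            gcongr
            exact midpoint_rpow_neg_le _ _ hβ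
        _ = 2⁻¹ * ((∫⁻ x, G m x * rieszPotential α f x ^ (-β)) +
              ∫⁻ x, G m x * rieszPotential α g x ^ (-β)) := by
            rw [lintegral_const_mul' _ _ (by simp), lintegral_add_left' hmf]
        _ ≤ 2⁻¹ * (c m + c m) := by gcongr; exacts [hf.2, hg.2]
        _ = c m := by
            rw [← two_mul, ← mul_assoc, ENNReal.inv_mul_cancel two_ne_zero (by simp), one_mul]⟩)
  replace hlim : ∀ᵐ x, Tendsto (fun m => h m x) atTop (𝓝 (h₀ x)) := ae_of_ae_mul_refWeight hlim
  have hhm : ∀ m, AEMeasurable (h m) := fun m => (hhC m).1.1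
  have hh₀m : AEMeasurable h₀ := aemeasurable_of_tendsto_metrizable_ae atTop hhm hlim
  have hh₀s : ∫⁻ x, h₀ x ^ s ≤ 1 := by
    calc ∫⁻ x, h₀ x ^ s = ∫⁻ x, liminf (fun m => h m x ^ s) atTop := by
          refine lintegral_congr_ae ?_
          filter_upwards [hlim] with x hx
          exact (((ENNReal.continuous_rpow_const (y := s)).tendsto _).comp hx).liminf_eq.symm
      _ ≤ liminf (fun m => ∫⁻ x, h m x ^ s) atTop :=
          lintegral_liminf_le' fun m => (hhm m).pow_const s
      _ ≤ 1 := liminf_le_of_frequently_le' (Frequently.of_forall fun m => (hhC m).1.2)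
  have hh₀fin : ∀ᵐ x, h₀ x ≠ ∞ := by
    filter_upwards [ae_lt_top' (hh₀m.pow_const s) (hh₀s.trans_lt ENNReal.one_lt_top).ne] with x hx e
    rw [e, ENNReal.top_rpow_of_pos hs0] at hx
    exact lt_irrefl _ hx
  -- Truncated subtraction: only the positive part of h_m - h₀ matters, because only an upper bound
  -- for the potential of h_m is needed.
  let u : ℕ → Rn n → ℝ≥0∞ := fun m x => h m x - h₀ x
  have hum : ∀ m, AEMeasurable (u m) := fun m => (hhm m).sub hh₀m
  obtain ⟨φ, hφ, hφu⟩ := exists_subseq_ae_tendsto_rieszPotential_zero hs hα hαn hum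
    (fun m => (lintegral_mono fun x => by gcongr; exact tsub_le_self).trans (hhC m).1.2)
    (by
      filter_upwards [hlim, hh₀fin] with x hx hx0
      have := ENNReal.Tendsto.sub hx (tendsto_const_nhds (x := h₀ x)) (Or.inr hx0)
      simpa using this)
  refine ⟨h₀, ⟨hh₀m, hh₀s⟩, ?_⟩
  have hI : ∀ m x, rieszPotential α (h m) x ≤
      rieszPotential α h₀ x + rieszPotential α (u m) x := by
    intro m x
    rw [← rieszPotential_add hh₀m]
    exact rieszPotential_mono_ae (Eventually.of_forall fun y => le_add_tsub) x
  have hFm : ∀ m, AEMeasurable fun x => G (φ m) x *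
      (rieszPotential α h₀ x + rieszPotential α (u (φ m)) x) ^ (-β) := fun m =>
    (hG _).mul (((measurable_rieszPotential hh₀m).add
      (measurable_rieszPotential (hum _))).pow_const _).aemeasurable
  calc ∫⁻ x, G₀ x * rieszPotential α h₀ x ^ (-β)
      ≤ ∫⁻ x, liminf (fun m => G (φ m) x *
          (rieszPotential α h₀ x + rieszPotential α (u (φ m)) x) ^ (-β)) atTop := by
        refine lintegral_mono_ae ?_
        filter_upwards [hφu] with x hx
        -- Zeros of G₀ are separated because the potential of h₀ may vanish there, giving an
        -- indeterminate product 0 · ∞.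
        by_cases hGx : G₀ x = 0
        · simp [hGx]
        have h1 := (tendsto_const_nhds (x := rieszPotential α h₀ x)).add hx
        rw [add_zero] at h1
        have h2 := ((ENNReal.continuous_rpow_const (y := -β)).tendsto _).comp h1
        have h3 := ENNReal.Tendsto.mul ((hGlim x).comp hφ.tendsto_atTop) (Or.inl hGx) h2
          (Or.inr (hG₀ x))
        exact h3.liminf_eq.ge
    _ ≤ liminf (fun m => ∫⁻ x, G (φ m) x *
          (rieszPotential α h₀ x + rieszPotential α (u (φ m)) x) ^ (-β)) atTop :=
        lintegral_liminf_le' hFm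
    _ ≤ liminf (fun m => c (φ m)) atTop := by
        refine liminf_le_liminf (Eventually.of_forall fun m => ?_)
        refine (lintegral_mono fun x => ?_).trans (hhC (φ m)).2
        exact mul_le_mul' le_rfl (ennreal_rpow_le_rpow_of_nonpos (hI _ x) (by linarith))
    _ = c₀ := (hclim.comp hφ.tendsto_atTop).liminf_eq

end

/-! ### Both norms as extremal problems over the unit ball of L^s -/

section

variable {n : ℕ} {α s r p q : ℝ}

/-! ### The `L^s` norm and the capacity -/

theorem eLpNorm_ofReal_eq (hs : 0 < s) (f : Rn n → ℝ≥0∞) :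
    eLpNorm f (ENNReal.ofReal s) volume = (∫⁻ x, f x ^ s) ^ (1 / s) := by
  rw [eLpNorm_eq_lintegral_rpow_enorm_toReal (by simpa using hs) ENNReal.ofReal_ne_top,
    ENNReal.toReal_ofReal hs.le]
  simp

theorem isNonnegLs_iff (hs : 0 < s) {f : Rn n → ℝ≥0∞} :
    IsNonnegLs s f ↔ AEMeasurable f ∧ ∫⁻ x, f x ^ s < ∞ := by
  rw [IsNonnegLs, eLpNorm_ofReal_eq hs, ENNReal.rpow_lt_top_iff_of_pos (by positivity)]

theorem mem_lsBall_iff (hs : 0 < s) {f : Rn n → ℝ≥0∞} :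
    f ∈ lsBall n s ↔ IsNonnegLs s f ∧ eLpNorm f (ENNReal.ofReal s) volume ≤ 1 := by
  have h1 : eLpNorm f (ENNReal.ofReal s) volume ≤ 1 ↔ ∫⁻ x, f x ^ s ≤ 1 := by
    rw [eLpNorm_ofReal_eq hs, one_div, ENNReal.rpow_inv_le_iff hs, ENNReal.one_rpow]
  rw [isNonnegLs_iff hs, h1]
  exact ⟨fun h => ⟨⟨h.1, h.2.trans_lt ENNReal.one_lt_top⟩, h.2⟩, fun h => ⟨h.1.1, h.2⟩⟩

theorem isNonnegLs_of_mem_lsBall (hs : 0 < s) {f : Rn n → ℝ≥0∞} (hf : f ∈ lsBall n s) :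
    IsNonnegLs s f := ((mem_lsBall_iff hs).1 hf).1

/-- Normalization of an element of `L^s`. -/
theorem inv_mul_mem_lsBall (hs : 0 < s) {f : Rn n → ℝ≥0∞} (hf : IsNonnegLs s f) {c : ℝ≥0∞}
    (hc0 : c ≠ 0) (hfc : eLpNorm f (ENNReal.ofReal s) volume ≤ c) :
    (fun x => c⁻¹ * f x) ∈ lsBall n s := by
  refine ⟨hf.1.const_mul _, ?_⟩
  have hci : c⁻¹ ≠ ∞ := ENNReal.inv_ne_top.2 hc0
  simp only [ENNReal.mul_rpow_of_nonneg _ _ hs.le]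
  rw [lintegral_const_mul' _ _ (ENNReal.rpow_lt_top_of_nonneg hs.le hci).ne, ENNReal.inv_rpow]
  rw [eLpNorm_ofReal_eq hs, one_div, ENNReal.rpow_inv_le_iff hs] at hfc
  refine (mul_le_mul' le_rfl hfc).trans (ENNReal.inv_mul_le_one _)

theorem rieszPotential_inv_mul {f : Rn n → ℝ≥0∞} {c : ℝ≥0∞} (hc0 : c ≠ 0) (hc : c ≠ ∞) (x : Rn n) :
    rieszPotential α f x = c * rieszPotential α (fun y => c⁻¹ * f y) x := by
  rw [rieszPotential_const_mul (ENNReal.inv_ne_top.2 hc0), ← mul_assoc,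
    ENNReal.mul_inv_cancel hc0 hc, one_mul]

/-- Chebyshev's inequality and the weighted L¹ bound give ν(E) ≤ D ‖f‖_s for every f admissible for
E, where ν has the positive density `refWeight n`. -/
theorem volume_eq_zero_of_rieszCap_eq_zero (hs : 1 < s) (hα : 0 < α) (hαn : α < (n : ℝ) / s)
    {E : Set (Rn n)} (hE : rieszCap α s E = 0) : volume E = 0 := by
  have hs0 : 0 < s := by linarith
  set D := (∫⁻ x, rieszPotential α (refWeight n) x ^ s.conjExponent) ^ (1 / s.conjExponent)
  have hτ := (Real.HolderConjugate.conjExponent hs).symm.pos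
  have hD : D ≠ ∞ := (ENNReal.rpow_lt_top_of_nonneg (by positivity)
    (lintegral_rieszPotential_refWeight_lt_top hs hα hαn).ne).ne
  let ν : Measure (Rn n) := volume.withDensity (refWeight n)
  have : IsFiniteMeasure ν := isFiniteMeasure_withDensity lintegral_refWeight_lt_top.ne
  have hac : volume ≪ ν := withDensity_absolutelyContinuous'
    measurable_refWeight.aemeasurable (Eventually.of_forall fun x => (refWeight_pos x).ne')
  refine hac ?_
  by_contra hne
  -- Dividing by D + 1 rather than D keeps the final inequality strict and covers D = 0.
  have hδ0 : 0 < ν E / (D + 1) :=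
    ENNReal.div_pos hne (ENNReal.add_ne_top.2 ⟨hD, ENNReal.one_ne_top⟩)
  have hδ : rieszCap α s E < (ν E / (D + 1)) ^ s := by
    rw [hE]; exact ENNReal.rpow_pos_of_nonneg hδ0 hs0.le
  simp only [rieszCap, iInf_lt_iff] at hδ
  obtain ⟨f, hf, hfE, hlt⟩ := hδ
  rw [ENNReal.rpow_lt_rpow_iff hs0] at hlt
  have h1 : ν E ≤ D * (ν E / (D + 1)) := by
    calc ν E ≤ ν {x | 1 ≤ rieszPotential α f x} := measure_mono hfE
      _ ≤ ∫⁻ x, rieszPotential α f x ∂ν := by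
          have := mul_meas_ge_le_lintegral (μ := ν) (measurable_rieszPotential (α := α) hf.1) 1
          rwa [one_mul] at this
      _ = ∫⁻ x, rieszPotential α f x * refWeight n x := by
          rw [lintegral_withDensity_eq_lintegral_mul _ measurable_refWeight
            (measurable_rieszPotential hf.1)]
          exact lintegral_congr fun x => mul_comm _ _
      _ ≤ eLpNorm f (ENNReal.ofReal s) volume * D := by
          rw [eLpNorm_ofReal_eq hs0]
          exact lintegral_rieszPotential_mul_refWeight_le hs hf.1
      _ ≤ _ := by rw [mul_comm]; gcongr
  have hDδ : D * (ν E / (D + 1)) ≠ ∞ := ENNReal.mul_ne_top hD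
    (ENNReal.div_ne_top (measure_ne_top _ _) (by simp))
  have h2 : D * (ν E / (D + 1)) < ν E := by
    calc D * (ν E / (D + 1)) < D * (ν E / (D + 1)) + ν E / (D + 1) :=
          ENNReal.lt_add_right hDδ hδ0.ne'
      _ = (D + 1) * (ν E / (D + 1)) := by ring
      _ = ν E := ENNReal.mul_div_cancel (by simp) (by simp [hD])
  exact absurd h1 (not_le.2 h2)

theorem ae_of_quasiEverywhere (hs : 1 < s) (hα : 0 < α) (hαn : α < (n : ℝ) / s)
    {P : Rn n → Prop} (h : QuasiEverywhere α s P) : ∀ᵐ x, P x :=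
  ae_iff.2 (volume_eq_zero_of_rieszCap_eq_zero hs hα hαn h)

theorem quasiEverywhere_of_forall (hs : 0 < s) {P : Rn n → Prop} (h : ∀ x, P x) :
    QuasiEverywhere α s P := by
  have : {x | ¬ P x} = ∅ := by ext x; simp [h x]
  rw [QuasiEverywhere, this, rieszCap]
  refine le_antisymm ?_ zero_le
  refine iInf_le_of_le (fun _ => 0) (iInf_le_of_le ?_ (iInf_le_of_le (by simp) ?_))
  · rw [isNonnegLs_iff hs]; simp [hs]
  · rw [eLpNorm_ofReal_eq hs]; simp [hs]

/-! ### Weights given by potentials -/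

theorem isWeight_rieszPotential_rpow (hs : 1 < s) (hα : 0 < α) (hαn : α < (n : ℝ) / s) (hr : 0 < r)
    (hrs : r ≤ s) {h : Rn n → ℝ≥0∞} (hh : IsNonnegLs s h) :
    IsWeight (fun x => rieszPotential α h x ^ r) := by
  have hs0 : 0 < s := by linarith
  obtain ⟨hm, hi⟩ := (isNonnegLs_iff hs0).1 hh
  refine ⟨((measurable_rieszPotential hm).pow_const r).aemeasurable, fun K hK => ?_⟩
  have hpt : ∀ a : ℝ≥0∞, a ^ r ≤ 1 + a ^ s := by
    intro a
    rcases le_total a 1 with ha | ha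
    · exact (ENNReal.rpow_le_one ha hr.le).trans le_self_add
    · exact (ENNReal.rpow_le_rpow_of_exponent_le ha hrs).trans le_add_self
  refine (lintegral_mono fun x => hpt _).trans_lt ?_
  rw [lintegral_add_left measurable_const]
  refine ENNReal.add_lt_top.2 ⟨?_, setLIntegral_rieszPotential_rpow_lt_top hs hα hαn hm hi hK⟩
  simpa using hK.measure_lt_top

theorem fNorm_rieszPotential_rpow_le (hs : 0 < s) (hr : 0 < r) {h : Rn n → ℝ≥0∞}
    (hh : IsNonnegLs s h) :
    fNorm α s r (fun x => rieszPotential α h x ^ r) ≤ eLpNorm h (ENNReal.ofReal s) volume ^ r := by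
  refine iInf_le_of_le h (iInf_le_of_le hh (iInf_le_of_le ?_ le_rfl))
  refine quasiEverywhere_of_forall hs fun x => ?_
  rw [← ENNReal.rpow_mul, mul_one_div_cancel hr.ne', ENNReal.rpow_one]

/-- The power (I_α h)^r is itself an admissible weight; r ≤ s makes it locally integrable. -/
theorem nBarNorm_le_of_mem_lsBall (hs : 1 < s) (hα : 0 < α) (hαn : α < (n : ℝ) / s) (hr : 0 < r)
    (hrs : r ≤ s) {h : Rn n → ℝ≥0∞} (hh : h ∈ lsBall n s) (g : Rn n → ℝ) :
    nBarNorm α s r q g ≤ (∫⁻ x, ‖g x‖ₑ ^ q * (rieszPotential α h x ^ r) ^ (1 - q)) ^ (1 / q) := by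
  have hs0 : 0 < s := by linarith
  obtain ⟨h1, h2⟩ := (mem_lsBall_iff hs0).1 hh
  refine iInf_le_of_le (fun x => rieszPotential α h x ^ r) (iInf_le_of_le
    (isWeight_rieszPotential_rpow hs hα hαn hr hrs h1) (iInf_le_of_le ?_ le_rfl))
  exact (fNorm_rieszPotential_rpow_le hs0 hr h1).trans (ENNReal.rpow_le_one h2 hr.le)

/-- The reverse reduction, from arbitrary weights to powers of potentials. The factor t > 1 absorbs
the possible non-attainment in `fNorm`; the near-optimal f is scaled by t^{-1/r}. -/
theorem exists_mem_lsBall_ae_le (hs : 1 < s) (hα : 0 < α) (hαn : α < (n : ℝ) / s) (hr : 0 < r)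
    {w : Rn n → ℝ≥0∞} (hw : fNorm α s r w ≤ 1) {t : ℝ≥0∞} (ht1 : 1 < t) (ht : t ≠ ∞) :
    ∃ h ∈ lsBall n s, ∀ᵐ x, w x ≤ t * rieszPotential α h x ^ r := by
  have hs0 : 0 < s := by linarith
  have hlt := hw.trans_lt ht1
  simp only [fNorm, iInf_lt_iff] at hlt
  obtain ⟨f, hf, hqe, hlt⟩ := hlt
  set c := t ^ (1 / r)
  have hc0 : c ≠ 0 := (ENNReal.rpow_pos (zero_lt_one.trans ht1) ht).ne'
  have hc : c ≠ ∞ := (ENNReal.rpow_lt_top_of_nonneg (by positivity) ht).ne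
  have hcr : c ^ r = t := by
    rw [← ENNReal.rpow_mul, one_div_mul_cancel hr.ne', ENNReal.rpow_one]
  have hfc : eLpNorm f (ENNReal.ofReal s) volume ≤ c := by
    rw [← ENNReal.rpow_le_rpow_iff hr, hcr]; exact hlt.le
  refine ⟨_, inv_mul_mem_lsBall hs0 hf hc0 hfc, ?_⟩
  filter_upwards [ae_of_quasiEverywhere hs hα hαn hqe] with x hx
  rw [one_div, ENNReal.rpow_inv_le_iff hr, rieszPotential_inv_mul hc0 hc,
    ENNReal.mul_rpow_of_nonneg _ _ hr.le, hcr] at hx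
  exact hx

/-- The Fatou property of `nBarNorm`, with attainment of the infimum. -/
theorem exists_mem_lsBall_lintegral_le_rpow (hs : 1 < s) (hα : 0 < α) (hαn : α < (n : ℝ) / s)
    (hr : 0 < r) (hq : 1 < q) {g : ℕ → Rn n → ℝ} {g₀ : Rn n → ℝ} (hg : ∀ m, AEMeasurable (g m))
    (hmono : ∀ x, Monotone fun m => ‖g m x‖ₑ)
    (hlim : ∀ x, Tendsto (fun m => ‖g m x‖ₑ) atTop (𝓝 ‖g₀ x‖ₑ)) {N : ℝ≥0∞} (hN : N ≠ ∞)
    (hgN : ∀ m, nBarNorm α s r q (g m) ≤ N) :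
    ∃ h ∈ lsBall n s, ∫⁻ x, ‖g₀ x‖ₑ ^ q * (rieszPotential α h x ^ r) ^ (1 - q) ≤ N ^ q := by
  have hq0 : 0 < q := by linarith
  have hpow : ∀ a : ℝ≥0∞, (a ^ r) ^ (1 - q) = a ^ (-(r * (q - 1))) := by
    intro a; rw [← ENNReal.rpow_mul]; congr 1; ring
  let e : ℕ → ℝ≥0∞ := fun m => ((m : ℝ≥0∞) + 1)⁻¹
  have he0 : ∀ m, 0 < e m := fun m => by simp [e, ENNReal.add_eq_top]
  have het : ∀ m, e m ≠ ∞ := fun m => by simp [e]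
  have heanti : Antitone e := fun i j hij => by simp only [e]; gcongr
  have helim : Tendsto e atTop (𝓝 0) := by
    have := (tendsto_add_atTop_iff_nat 1).2 ENNReal.tendsto_inv_nat_nhds_zero
    simpa [e] using this
  -- The second factor bounds the integral for a nearly optimal weight; the first is the cost of
  -- replacing that weight by (1 + e_m) (I_α h)^r.
  let c : ℕ → ℝ≥0∞ := fun m => (1 + e m) ^ (q - 1) * (N + e m) ^ q
  have hcanti : Antitone c := fun i j hij => by
    have := heanti hij
    exact mul_le_mul' (ENNReal.rpow_le_rpow (by gcongr) (by linarith))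
      (ENNReal.rpow_le_rpow (by gcongr) hq0.le)
  have hclim : Tendsto c atTop (𝓝 (N ^ q)) := by
    have h1 : Tendsto (fun m => (1 + e m) ^ (q - 1)) atTop (𝓝 1) := by
      have := ((ENNReal.continuous_rpow_const (y := q - 1)).tendsto _).comp
        ((tendsto_const_nhds (x := (1 : ℝ≥0∞))).add helim)
      simpa [Function.comp_def] using this
    have h2 : Tendsto (fun m => (N + e m) ^ q) atTop (𝓝 (N ^ q)) := by
      have := ((ENNReal.continuous_rpow_const (y := q)).tendsto _).comp
        ((tendsto_const_nhds (x := N)).add helim)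
      simpa [Function.comp_def] using this
    have := ENNReal.Tendsto.mul h1 (Or.inl one_ne_zero) h2 (Or.inr ENNReal.one_ne_top)
    simpa using this
  have key := exists_mem_lsBall_lintegral_rpow_neg_le hs hα hαn (β := r * (q - 1))
    (mul_pos hr (by linarith)) (G := fun m x => ‖g m x‖ₑ ^ q) (G₀ := fun x => ‖g₀ x‖ₑ ^ q)
    (fun m => (hg m).enorm.pow_const q)
    (fun i j hij x => ENNReal.rpow_le_rpow (hmono x hij) hq0.le)
    (fun x => ((ENNReal.continuous_rpow_const (y := q)).tendsto _).comp (hlim x))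
    (fun x => (ENNReal.rpow_lt_top_of_nonneg hq0.le enorm_ne_top).ne) hcanti hclim ?_
  · simpa only [hpow] using key
  · intro m
    have hlt : nBarNorm α s r q (g m) < N + e m :=
      (hgN m).trans_lt (ENNReal.lt_add_right hN (he0 m).ne')
    simp only [nBarNorm, iInf_lt_iff] at hlt
    obtain ⟨w, -, hwF, hwlt⟩ := hlt
    rw [one_div, ENNReal.rpow_inv_lt_iff hq0] at hwlt
    have ht1 : 1 < 1 + e m := ENNReal.lt_add_right ENNReal.one_ne_top (he0 m).ne'
    have ht : 1 + e m ≠ ∞ := ENNReal.add_ne_top.2 ⟨ENNReal.one_ne_top, het m⟩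
    have ht0 : 1 + e m ≠ 0 := (zero_lt_one.trans ht1).ne'
    obtain ⟨h, hh, hle⟩ := exists_mem_lsBall_ae_le hs hα hαn hr hwF ht1 ht
    refine ⟨h, hh, ?_⟩
    have htq : (1 + e m) ^ (q - 1) ≠ ∞ := (ENNReal.rpow_lt_top_of_nonneg (by linarith) ht).ne
    calc ∫⁻ x, ‖g m x‖ₑ ^ q * rieszPotential α h x ^ (-(r * (q - 1)))
        ≤ ∫⁻ x, (1 + e m) ^ (q - 1) * (‖g m x‖ₑ ^ q * w x ^ (1 - q)) := by
          refine lintegral_mono_ae ?_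
          filter_upwards [hle] with x hx
          rw [mul_left_comm, ← hpow]
          refine mul_le_mul' le_rfl ?_
          have h1 := ennreal_rpow_le_rpow_of_nonpos hx (z := 1 - q) (by linarith)
          rw [ennreal_mul_rpow_of_neg ht0 ht (by linarith)] at h1
          calc (rieszPotential α h x ^ r) ^ (1 - q)
              = (1 + e m) ^ (q - 1) * ((1 + e m) ^ (1 - q) *
                  (rieszPotential α h x ^ r) ^ (1 - q)) := by
                rw [← mul_assoc, ← ENNReal.rpow_add _ _ ht0 ht, sub_add_sub_cancel, sub_self,
                  ENNReal.rpow_zero, one_mul]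
            _ ≤ _ := mul_le_mul' le_rfl h1
      _ ≤ c m := by
          rw [lintegral_const_mul' _ _ htq]
          exact mul_le_mul' le_rfl hwlt.le

/-! ### The trace inequality -/

/-- Both sides of the trace inequality are homogeneous in h; the case of norm 0, where h cannot be
normalized, is trivial because its potential vanishes. -/
theorem traceInequality_iff (hs : 0 < s) (hr : 0 < r) (hp : 0 < p) {f : Rn n → ℝ} {C : ℝ≥0} :
    TraceInequality α s p r f C ↔
      ∀ h ∈ lsBall n s, ∫⁻ x, rieszPotential α h x ^ r * ‖f x‖ₑ ^ p ≤ (C : ℝ≥0∞) ^ p := by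
  constructor
  · intro H h hh
    obtain ⟨h1, h2⟩ := (mem_lsBall_iff hs).1 hh
    have h3 := H h h1
    rw [← ENNReal.rpow_inv_le_iff hp, ← one_div]
    refine h3.trans ?_
    calc (C : ℝ≥0∞) * eLpNorm h (ENNReal.ofReal s) volume ^ (r / p) ≤ C * 1 := by
          gcongr; exact ENNReal.rpow_le_one h2 (by positivity)
      _ = C := mul_one _
  · intro H h hh
    set c := eLpNorm h (ENNReal.ofReal s) volume with hcdef
    have hc : c ≠ ∞ := hh.2.ne
    by_cases hc0 : c = 0
    · have hh0 : h =ᵐ[volume] fun _ => 0 := by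
        rw [hcdef, eLpNorm_ofReal_eq hs, ENNReal.rpow_eq_zero_iff_of_pos (by positivity),
          lintegral_eq_zero_iff' (hh.1.pow_const s)] at hc0
        filter_upwards [hc0] with x hx
        simpa [hs] using (ENNReal.rpow_eq_zero_iff_of_pos hs).1 hx
      have hI : ∀ x, rieszPotential α h x = 0 := by
        intro x
        refine le_antisymm ((rieszPotential_mono_ae hh0.le x).trans ?_) zero_le
        simp [rieszPotential]
      simp [hI, hr, hp]
    · have h1 := H _ (inv_mul_mem_lsBall hs hh hc0 le_rfl)
      have hcr : c ^ r ≠ ∞ := (ENNReal.rpow_lt_top_of_nonneg hr.le hc).ne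
      have h2 : ∫⁻ x, rieszPotential α h x ^ r * ‖f x‖ₑ ^ p ≤ c ^ r * (C : ℝ≥0∞) ^ p := by
        refine le_trans (le_of_eq ?_) (mul_le_mul' le_rfl h1)
        rw [← lintegral_const_mul' _ _ hcr]
        refine lintegral_congr fun x => ?_
        rw [rieszPotential_inv_mul (α := α) (f := h) hc0 hc x, ENNReal.mul_rpow_of_nonneg _ _ hr.le,
          mul_assoc]
      calc (∫⁻ x, rieszPotential α h x ^ r * ‖f x‖ₑ ^ p) ^ (1 / p)
          ≤ (c ^ r * (C : ℝ≥0∞) ^ p) ^ (1 / p) := by gcongr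
        _ = C * c ^ (r / p) := by
            rw [ENNReal.mul_rpow_of_nonneg _ _ (by positivity), ← ENNReal.rpow_mul,
              ← ENNReal.rpow_mul, mul_one_div_cancel hp.ne', ENNReal.rpow_one, mul_comm, mul_one_div]

theorem mNorm_le_iff (hs : 0 < s) (hr : 0 < r) (hp : 0 < p) {f : Rn n → ℝ} {C : ℝ≥0} :
    mNorm α s p r f ≤ C ↔
      ∀ h ∈ lsBall n s, ∫⁻ x, rieszPotential α h x ^ r * ‖f x‖ₑ ^ p ≤ (C : ℝ≥0∞) ^ p := by
  constructor
  · intro H h hh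
    rw [← ENNReal.rpow_inv_le_iff hp]
    refine ENNReal.le_of_forall_pos_le_add fun ε hε _ => ?_
    have hlt : mNorm α s p r f < C + ε :=
      H.trans_lt (ENNReal.lt_add_right ENNReal.coe_ne_top (by simpa using hε.ne'))
    simp only [mNorm, iInf_lt_iff] at hlt
    obtain ⟨C', hC', hlt⟩ := hlt
    have := (traceInequality_iff hs hr hp).1 hC' h hh
    rw [← ENNReal.rpow_inv_le_iff hp] at this
    exact this.trans hlt.le
  · intro H
    exact iInf_le_of_le C (iInf_le_of_le ((traceInequality_iff hs hr hp).2 H) le_rfl)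

/-- Local p-integrability is automatic: test the trace inequality with an h whose potential is
bounded below on K. -/
theorem mem_mSpace_iff (hs : 1 < s) (hα : 0 < α) (hαn : α < (n : ℝ) / s) (hr : 0 < r)
    (hp : 0 < p) {f : Rn n → ℝ} :
    f ∈ mSpace n α s p r ↔ AEMeasurable f ∧ mNorm α s p r f < ∞ := by
  have hs0 : 0 < s := by linarith
  constructor
  · rintro ⟨hf, -, C, hC⟩
    exact ⟨hf, (iInf_le_of_le C (iInf_le_of_le hC le_rfl)).trans_lt ENNReal.coe_lt_top⟩
  · rintro ⟨hf, hlt⟩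
    simp only [mNorm, iInf_lt_iff] at hlt
    obtain ⟨C, hC, -⟩ := hlt
    refine ⟨hf, fun K hK => ⟨hf.aestronglyMeasurable.restrict, ?_⟩, C, hC⟩
    obtain ⟨h, hm, hhs, c, hc0, hle⟩ :=
      exists_rieszPotential_ge hα (lt_natCast_of_lt_div hs hαn) hs0 hK
    have hh : IsNonnegLs s h := (isNonnegLs_iff hs0).2 ⟨hm.aemeasurable, hhs⟩
    have h1 : (∫⁻ x, rieszPotential α h x ^ r * ‖f x‖ₑ ^ p) < ∞ := by
      have h2 : (C : ℝ≥0∞) * eLpNorm h (ENNReal.ofReal s) volume ^ (r / p) < ∞ :=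
        ENNReal.mul_lt_top ENNReal.coe_lt_top
          (ENNReal.rpow_lt_top_of_nonneg (by positivity) hh.2.ne)
      rw [← ENNReal.rpow_lt_top_iff_of_pos (show 0 < 1 / p by positivity)]
      exact (hC h hh).trans_lt h2
    -- The cap at 1 ensures a finite constant, so that it can be moved through the integral.
    set b := min c 1 with hb
    have hb0 : b ≠ 0 := (lt_min hc0 zero_lt_one).ne'
    have hbt : b ≠ ∞ := ne_top_of_le_ne_top ENNReal.one_ne_top (min_le_right _ _)
    have hbr0 : b ^ r ≠ 0 := (ENNReal.rpow_pos hb0.bot_lt hbt).ne'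
    have hbrt : b ^ r ≠ ∞ := (ENNReal.rpow_lt_top_of_nonneg hr.le hbt).ne
    rw [eLpNorm_eq_lintegral_rpow_enorm_toReal (by simpa using hp) ENNReal.ofReal_ne_top,
      ENNReal.toReal_ofReal hp.le]
    refine ENNReal.rpow_lt_top_of_nonneg (by positivity) (ne_of_lt ?_)
    have h3 : b ^ r * ∫⁻ x in K, ‖f x‖ₑ ^ p < ∞ := by
      rw [← lintegral_const_mul' _ _ hbrt]
      refine lt_of_le_of_lt ?_ h1
      refine le_trans (setLIntegral_mono_ae' hK.measurableSet (Eventually.of_forall fun x hx => ?_))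
        (setLIntegral_le_lintegral K _)
      gcongr
      exact (min_le_left _ _).trans (hle x hx)
    exact (ENNReal.mul_lt_top_iff.1 h3).elim (fun h => h.2) fun h => h.elim
      (fun h => absurd h hbr0) fun h => by rw [h]; exact ENNReal.zero_lt_top

end

/-! ### The pairing inequality, dual test functions and tools for gliding humps -/

section

variable {n : ℕ} {α s r p q : ℝ}

/-! ### Hölder's inequality -/

theorem lintegral_enorm_mul_le_weighted {X : Type*} [MeasurableSpace X] {μ : Measure X}
    (hpq : p.HolderConjugate q) {f g : X → ℝ} {w : X → ℝ≥0∞} (hf : AEMeasurable f μ)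
    (hg : AEMeasurable g μ) (hw : AEMeasurable w μ) (hwt : ∀ᵐ x ∂μ, w x ≠ ∞)
    (hgw : ∫⁻ x, ‖g x‖ₑ ^ q * w x ^ (1 - q) ∂μ ≠ ∞) :
    ∫⁻ x, ‖f x * g x‖ₑ ∂μ ≤ (∫⁻ x, w x * ‖f x‖ₑ ^ p ∂μ) ^ (1 / p) *
      (∫⁻ x, ‖g x‖ₑ ^ q * w x ^ (1 - q) ∂μ) ^ (1 / q) := by
  have hp0 := hpq.pos
  have hq0 := hpq.symm.pos
  have hq1 := hpq.symm.lt
  have h1 := ENNReal.lintegral_mul_le_Lp_mul_Lq μ hpq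
    (f := fun x => w x ^ (1 / p) * ‖f x‖ₑ) (g := fun x => ‖g x‖ₑ * w x ^ (-(1 / p)))
    ((hw.pow_const _).mul hf.enorm) (hg.enorm.mul (hw.pow_const _))
  have e1 : ∀ x, (w x ^ (1 / p) * ‖f x‖ₑ) ^ p = w x * ‖f x‖ₑ ^ p := by
    intro x
    rw [ENNReal.mul_rpow_of_nonneg _ _ hp0.le, ← ENNReal.rpow_mul, one_div_mul_cancel hp0.ne',
      ENNReal.rpow_one]
  have e2 : ∀ x, (‖g x‖ₑ * w x ^ (-(1 / p))) ^ q = ‖g x‖ₑ ^ q * w x ^ (1 - q) := by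
    intro x
    rw [ENNReal.mul_rpow_of_nonneg _ _ hq0.le, ← ENNReal.rpow_mul]
    congr 2
    have := hpq.symm.sub_one_mul_conj
    field_simp
    linarith
  simp only [e1, e2] at h1
  refine le_trans (lintegral_mono_ae ?_) h1
  filter_upwards [hwt, ae_lt_top' ((hg.enorm.pow_const q).mul (hw.pow_const (1 - q))) hgw]
    with x hx1 hx2
  simp only [Pi.mul_apply]
  rw [enorm_mul]
  by_cases hgx : ‖g x‖ₑ = 0
  · simp [hgx]
  -- Where w = 0 and g ≠ 0 the integrand |g|^q w^{1-q} is infinite, which finiteness excludes a.e.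
  have hw0 : w x ≠ 0 := by
    intro h0
    simp only [Pi.mul_apply] at hx2
    rw [h0, ENNReal.zero_rpow_of_neg (by linarith), ENNReal.mul_top] at hx2
    · exact lt_irrefl _ hx2
    · exact (ENNReal.rpow_pos (pos_iff_ne_zero.2 hgx) enorm_ne_top).ne'
  refine le_of_eq ?_
  calc ‖f x‖ₑ * ‖g x‖ₑ = (w x ^ (1 / p) * w x ^ (-(1 / p))) * (‖f x‖ₑ * ‖g x‖ₑ) := by
        rw [← ENNReal.rpow_add _ _ hw0 hx1, add_neg_cancel, ENNReal.rpow_zero, one_mul]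
    _ = _ := by ring

theorem ae_rieszPotential_ne_top (hs : 1 < s) (hα : 0 < α) (hαn : α < (n : ℝ) / s)
    {h : Rn n → ℝ≥0∞} (hh : h ∈ lsBall n s) : ∀ᵐ x, rieszPotential α h x ≠ ∞ := by
  have hs0 : 0 < s := by linarith
  have hτ := (Real.HolderConjugate.conjExponent hs).symm.pos
  have hm := measurable_rieszPotential (α := α) hh.1
  have hlt : ∫⁻ x, rieszPotential α h x * refWeight n x < ∞ := by
    refine (lintegral_rieszPotential_mul_refWeight_le hs hh.1).trans_lt (ENNReal.mul_lt_top ?_ ?_)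
    · exact ENNReal.rpow_lt_top_of_nonneg (by positivity)
        (hh.2.trans_lt ENNReal.one_lt_top).ne
    · exact ENNReal.rpow_lt_top_of_nonneg (by positivity)
        (lintegral_rieszPotential_refWeight_lt_top hs hα hαn).ne
  filter_upwards [ae_lt_top (hm.mul measurable_refWeight) hlt.ne] with x hx h0
  rw [Pi.mul_apply, h0, ENNReal.top_mul (refWeight_pos x).ne'] at hx
  exact lt_irrefl _ hx

/-- Since the infimum in `nBarNorm` is attained by a potential, a single application of weighted
Hölder suffices. -/
theorem lintegral_enorm_mul_le (hs : 1 < s) (hα : 0 < α) (hαn : α < (n : ℝ) / s)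
    (hr : 0 < r) (hpq : p.HolderConjugate q) {f g : Rn n → ℝ} (hf : AEMeasurable f)
    (hg : AEMeasurable g) {C : ℝ≥0} (hfC : mNorm α s p r f ≤ C)
    (hgt : nBarNorm α s r q g ≠ ∞) :
    ∫⁻ x, ‖f x * g x‖ₑ ≤ C * nBarNorm α s r q g := by
  have hs0 : 0 < s := by linarith
  have hp0 := hpq.pos
  have hq0 := hpq.symm.pos
  obtain ⟨h, hh, hle⟩ := exists_mem_lsBall_lintegral_le_rpow hs hα hαn hr hpq.symm.lt
    (g := fun _ => g) (fun _ => hg) (fun x => monotone_const) (fun x => tendsto_const_nhds) hgt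
    (fun _ => le_rfl)
  have h1 := (mNorm_le_iff hs0 hr hp0).1 hfC h hh
  refine (lintegral_enorm_mul_le_weighted hpq hf hg
    (((measurable_rieszPotential (α := α) hh.1).pow_const r).aemeasurable) ?_ ?_).trans ?_
  · filter_upwards [ae_rieszPotential_ne_top hs hα hαn hh] with x hx
    exact (ENNReal.rpow_lt_top_of_nonneg hr.le hx).ne
  · exact (hle.trans_lt (ENNReal.rpow_lt_top_of_nonneg hq0.le hgt)).ne
  · rw [one_div, one_div]
    exact mul_le_mul' ((ENNReal.rpow_inv_le_iff hp0).2 h1) ((ENNReal.rpow_inv_le_iff hq0).2 hle)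

theorem integrable_mul_of_mem (hs : 1 < s) (hα : 0 < α) (hαn : α < (n : ℝ) / s)
    (hr : 0 < r) (hpq : p.HolderConjugate q) {f g : Rn n → ℝ} (hf : f ∈ mSpace n α s p r)
    (hg : g ∈ nBarSpace n α s r q) : Integrable (fun x => f x * g x) := by
  obtain ⟨hfm, hft⟩ := (mem_mSpace_iff hs hα hαn hr hpq.pos).1 hf
  refine ⟨(hfm.mul hg.1).aestronglyMeasurable, ?_⟩
  rw [hasFiniteIntegral_iff_enorm]
  have := lintegral_enorm_mul_le hs hα hαn hr hpq hfm hg.1 (C := (mNorm α s p r f).toNNReal)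
    (by rw [ENNReal.coe_toNNReal hft.ne]) hg.2.ne
  exact this.trans_lt (ENNReal.mul_lt_top ENNReal.coe_lt_top hg.2)

/-! ### Truncation -/

/-- The set on which the truncation at height and radius `k` does not change `f`. -/
def truncSet (f : Rn n → ℝ) (k : ℕ) : Set (Rn n) := {x | ‖x‖ ≤ k ∧ ‖f x‖ ≤ k}

theorem nullMeasurableSet_truncSet {f : Rn n → ℝ} (hf : AEMeasurable f) (k : ℕ) :
    NullMeasurableSet (truncSet f k) :=
  (nullMeasurableSet_le measurable_norm.aemeasurable aemeasurable_const).inter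
    (nullMeasurableSet_le hf.norm aemeasurable_const)

theorem truncSet_mono (f : Rn n → ℝ) : Monotone (truncSet f) := fun i j hij x hx =>
  ⟨hx.1.trans (by exact_mod_cast hij), hx.2.trans (by exact_mod_cast hij)⟩

theorem eventually_mem_truncSet (f : Rn n → ℝ) (x : Rn n) : ∀ᶠ k in atTop, x ∈ truncSet f k := by
  obtain ⟨k, hk⟩ := exists_nat_ge (max ‖x‖ ‖f x‖)
  filter_upwards [eventually_ge_atTop k] with j hj
  have : (k : ℝ) ≤ j := by exact_mod_cast hj
  exact ⟨(le_max_left _ _).trans (hk.trans this), (le_max_right _ _).trans (hk.trans this)⟩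

theorem truncSet_subset_closedBall (f : Rn n → ℝ) (k : ℕ) :
    truncSet f k ⊆ Metric.closedBall 0 k := fun x hx => by simpa using hx.1

theorem lintegral_truncSet_lt_top {f : Rn n → ℝ} {k : ℕ} (hp : 0 ≤ p)
    {w : Rn n → ℝ≥0∞} (hw : ∫⁻ x in Metric.closedBall 0 k, w x < ∞) :
    ∫⁻ x, (truncSet f k).indicator (fun x => w x * ‖f x‖ₑ ^ p) x < ∞ := by
  have hk : (k : ℝ≥0∞) ^ p ≠ ∞ := (ENNReal.rpow_lt_top_of_nonneg hp (by simp)).ne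
  calc ∫⁻ x, (truncSet f k).indicator (fun x => w x * ‖f x‖ₑ ^ p) x
      ≤ ∫⁻ x, (k : ℝ≥0∞) ^ p * (Metric.closedBall (0 : Rn n) k).indicator w x := by
        refine lintegral_mono fun x => ?_
        by_cases hx : x ∈ truncSet f k
        · rw [Set.indicator_of_mem hx, Set.indicator_of_mem (truncSet_subset_closedBall f k hx),
            mul_comm]
          gcongr
          rw [← ofReal_norm, ← ENNReal.ofReal_natCast]
          exact ENNReal.ofReal_le_ofReal hx.2
        · simp [hx]
    _ = (k : ℝ≥0∞) ^ p * ∫⁻ x in Metric.closedBall 0 k, w x := by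
        rw [lintegral_const_mul' _ _ hk, lintegral_indicator Metric.isClosed_closedBall.measurableSet]
    _ < ∞ := ENNReal.mul_lt_top hk.lt_top hw

theorem lintegral_le_of_truncSet_le {f : Rn n → ℝ} (hf : AEMeasurable f) {F : Rn n → ℝ≥0∞}
    (hF : AEMeasurable F) {B : ℝ≥0∞} (h : ∀ k, ∫⁻ x, (truncSet f k).indicator F x ≤ B) :
    ∫⁻ x, F x ≤ B := by
  have hlim := lintegral_tendsto_of_tendsto_of_monotone (μ := (volume : Measure (Rn n)))
    (f := fun k => (truncSet f k).indicator F) (F := F)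
    (fun k => hF.indicator₀ (nullMeasurableSet_truncSet hf k))
    (Eventually.of_forall fun x i j hij =>
      Set.indicator_le_indicator_of_subset (truncSet_mono f hij) (fun _ => zero_le) x)
    (Eventually.of_forall fun x => by
      refine tendsto_const_nhds.congr' ?_
      filter_upwards [eventually_mem_truncSet f x] with k hk
      rw [Set.indicator_of_mem hk])
  exact le_of_tendsto' hlim h

/-! ### The trace inequality by duality -/

/-- The test function g = S^{-1/q} w |f|^{p-1}, cut off to `truncSet f k`, is the equality case of
Hölder for the weight w = (I_α h)^r: it satisfies ∫ |g|^q w^{1-q} = 1 and ∫ |fg| = S^{1/p}. The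
truncation makes S finite, w being locally integrable, and is removed by monotone convergence. -/
theorem lintegral_rieszPotential_rpow_le_of_dual (hs : 1 < s) (hα : 0 < α)
    (hαn : α < (n : ℝ) / s) (hr : 0 < r) (hrs : r ≤ s) (hpq : p.HolderConjugate q) {f : Rn n → ℝ}
    (hf : AEMeasurable f) {A : ℝ≥0∞}
    (hA : ∀ g ∈ nBarSpace n α s r q, nBarNorm α s r q g ≤ 1 → ∫⁻ x, ‖g x * f x‖ₑ ≤ A)
    {h : Rn n → ℝ≥0∞} (hh : h ∈ lsBall n s) :
    ∫⁻ x, rieszPotential α h x ^ r * ‖f x‖ₑ ^ p ≤ A ^ p := by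
  have hs0 : 0 < s := by linarith
  have hp0 := hpq.pos
  have hq0 := hpq.symm.pos
  have hq1 := hpq.symm.lt
  obtain ⟨w, hwdef⟩ : ∃ w : Rn n → ℝ≥0∞, w = fun x => rieszPotential α h x ^ r := ⟨_, rfl⟩
  have hwx : ∀ x, rieszPotential α h x ^ r = w x := fun x => by rw [hwdef]
  have hw : IsWeight w := by
    rw [hwdef]
    exact isWeight_rieszPotential_rpow hs hα hαn hr hrs (isNonnegLs_of_mem_lsBall hs0 hh)
  have hwt : ∀ᵐ x, w x ≠ ∞ := by
    filter_upwards [ae_rieszPotential_ne_top hs hα hαn hh] with x hx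
    rw [← hwx]
    exact (ENNReal.rpow_lt_top_of_nonneg hr.le hx).ne
  simp only [hwx]
  refine lintegral_le_of_truncSet_le hf (F := fun x => w x * ‖f x‖ₑ ^ p) (hw.1.mul (hf.enorm.pow_const p)) fun k => ?_
  set S := ∫⁻ x, (truncSet f k).indicator (fun x => w x * ‖f x‖ₑ ^ p) x
  have hSt : S ≠ ∞ := (lintegral_truncSet_lt_top hp0.le (hw.2 _ (isCompact_closedBall _ _))).ne
  by_cases hS0 : S = 0
  · rw [hS0]; exact zero_le
  set D := S ^ (1 / q)
  have hD0 : D ≠ 0 := (ENNReal.rpow_pos (pos_iff_ne_zero.2 hS0) hSt).ne'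
  have hDi : D⁻¹ ≠ ∞ := ENNReal.inv_ne_top.2 hD0
  have hDq : D ^ q = S := by
    rw [← ENNReal.rpow_mul, one_div_mul_cancel hq0.ne', ENNReal.rpow_one]
  let e : Rn n → ℝ≥0∞ := fun x =>
    D⁻¹ * (truncSet f k).indicator (fun x => w x * ‖f x‖ₑ ^ (p - 1)) x
  have hem : AEMeasurable e := (AEMeasurable.indicator₀ (hw.1.mul (hf.enorm.pow_const _))
    (nullMeasurableSet_truncSet hf k)).const_mul _
  let g : Rn n → ℝ := fun x => (e x).toReal
  have hge : ∀ᵐ x, ‖g x‖ₑ = e x := by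
    filter_upwards [hwt] with x hx
    have : e x ≠ ∞ := by
      refine ENNReal.mul_ne_top hDi ?_
      by_cases hxk : x ∈ truncSet f k
      · rw [Set.indicator_of_mem hxk]
        exact ENNReal.mul_ne_top hx
          (ENNReal.rpow_lt_top_of_nonneg (by linarith [hpq.lt]) enorm_ne_top).ne
      · simp [hxk]
    rw [Real.enorm_of_nonneg ENNReal.toReal_nonneg, ENNReal.ofReal_toReal this]
  have hgm : AEMeasurable g := hem.ennreal_toReal
  have hpq1 : (p - 1) * q = p := hpq.sub_one_mul_conj
  have hint : ∫⁻ x, ‖g x‖ₑ ^ q * w x ^ (1 - q) = 1 := by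
    have : ∫⁻ x, ‖g x‖ₑ ^ q * w x ^ (1 - q) =
        ∫⁻ x, S⁻¹ * (truncSet f k).indicator (fun x => w x * ‖f x‖ₑ ^ p) x := by
      refine lintegral_congr_ae ?_
      filter_upwards [hge, hwt] with x hx hxt
      rw [hx]
      simp only [e]
      rw [ENNReal.mul_rpow_of_nonneg _ _ hq0.le, ENNReal.inv_rpow, hDq, mul_assoc]
      congr 1
      by_cases hxk : x ∈ truncSet f k
      · rw [Set.indicator_of_mem hxk, Set.indicator_of_mem hxk,
          ENNReal.mul_rpow_of_nonneg _ _ hq0.le, ← ENNReal.rpow_mul, hpq1]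
        by_cases hw0 : w x = 0
        · simp [hw0, hq0]
        · rw [mul_right_comm, ← ENNReal.rpow_add _ _ hw0 hxt, add_sub_cancel, ENNReal.rpow_one]
      · simp [hxk, hq0]
    rw [this, lintegral_const_mul' _ _ (ENNReal.inv_ne_top.2 hS0), ENNReal.inv_mul_cancel hS0 hSt]
  have hgN : nBarNorm α s r q g ≤ 1 := by
    refine (nBarNorm_le_of_mem_lsBall hs hα hαn hr hrs hh g).trans (le_of_eq ?_)
    simp only [hwx]
    rw [hint, ENNReal.one_rpow]
  have h1 := hA g ⟨hgm, hgN.trans_lt ENNReal.one_lt_top⟩ hgN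
  have h2 : ∫⁻ x, ‖g x * f x‖ₑ = D⁻¹ * S := by
    rw [← lintegral_const_mul' _ _ hDi]
    refine lintegral_congr_ae ?_
    filter_upwards [hge] with x hx
    rw [enorm_mul, hx]
    simp only [e]
    rw [mul_assoc]
    congr 1
    by_cases hxk : x ∈ truncSet f k
    · rw [Set.indicator_of_mem hxk, Set.indicator_of_mem hxk, mul_assoc]
      congr 1
      nth_rewrite 2 [← ENNReal.rpow_one ‖f x‖ₑ]
      rw [← ENNReal.rpow_add_of_nonneg _ _ (by linarith [hpq.lt]) zero_le_one, sub_add_cancel]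
    · simp [hxk]
  have h3 : D⁻¹ * S = S ^ (1 / p) := by
    rw [← ENNReal.rpow_neg]
    nth_rewrite 2 [← ENNReal.rpow_one S]
    rw [← ENNReal.rpow_add _ _ hS0 hSt]
    congr 1
    have := hpq.inv_add_inv_eq_one
    rw [one_div, one_div]
    linarith
  rw [h2, h3, one_div, ENNReal.rpow_inv_le_iff hp0] at h1
  exact h1

/-! ### Gliding humps -/

/-- The witness is the pointwise ℓ^q norm of the sequence a_k g_k. Where that is infinite, `toReal`
returns 0; so the upper bound holds everywhere and the lower bounds only a.e. -/
theorem exists_real_dominating {X : Type*} [MeasurableSpace X] {μ : Measure X} (hq : 0 < q)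
    {g : ℕ → X → ℝ} (hg : ∀ k, AEMeasurable (g k) μ) {a : ℕ → ℝ≥0∞}
    (hfin : ∀ᵐ x ∂μ, ∑' k, a k ^ q * ‖g k x‖ₑ ^ q ≠ ∞) :
    ∃ g₀ : X → ℝ, AEMeasurable g₀ μ ∧ (∀ x, ‖g₀ x‖ₑ ^ q ≤ ∑' k, a k ^ q * ‖g k x‖ₑ ^ q) ∧
      ∀ᵐ x ∂μ, ∀ k, a k * ‖g k x‖ₑ ≤ ‖g₀ x‖ₑ := by
  let G : X → ℝ≥0∞ := fun x => ∑' k, a k ^ q * ‖g k x‖ₑ ^ q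
  have hG : AEMeasurable G μ := AEMeasurable.tsum fun k => ((hg k).enorm.pow_const q).const_mul _
  have hen : ∀ x, ‖(G x ^ (1 / q)).toReal‖ₑ ≤ G x ^ (1 / q) := by
    intro x
    rw [Real.enorm_of_nonneg ENNReal.toReal_nonneg]
    exact ENNReal.ofReal_toReal_le
  refine ⟨fun x => (G x ^ (1 / q)).toReal, (hG.pow_const _).ennreal_toReal, fun x => ?_, ?_⟩
  · rw [← ENNReal.le_rpow_inv_iff hq, ← one_div]
    exact hen x
  · filter_upwards [hfin] with x hx k
    rw [Real.enorm_of_nonneg ENNReal.toReal_nonneg, ENNReal.ofReal_toReal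
      (ENNReal.rpow_lt_top_of_nonneg (by positivity) hx).ne, one_div, ENNReal.le_rpow_inv_iff hq,
      ENNReal.mul_rpow_of_nonneg _ _ hq.le]
    exact ENNReal.le_tsum k

theorem tsum_inv_two_pow_succ : ∑' k : ℕ, (2⁻¹ : ℝ≥0∞) ^ (k + 1) = 1 := by
  simpa [ENNReal.inv_mul_cancel] using ENNReal.tsum_geometric_add_one (2⁻¹ : ℝ≥0∞)

theorem lintegral_eq_top_of_hump {X : Type*} [MeasurableSpace X] {μ : Measure X}
    {F : ℕ → X → ℝ≥0∞} {F₀ : X → ℝ≥0∞} (hle : ∀ᵐ x ∂μ, ∀ k, (2⁻¹ : ℝ≥0∞) ^ (k + 1) * F k x ≤ F₀ x)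
    (hF : ∀ k, (4 : ℝ≥0∞) ^ (k + 1) ≤ ∫⁻ x, F k x ∂μ) : ∫⁻ x, F₀ x ∂μ = ∞ := by
  have h1 : ∀ k : ℕ, (2 : ℝ≥0∞) ^ (k + 1) ≤ ∫⁻ x, F₀ x ∂μ := by
    intro k
    calc (2 : ℝ≥0∞) ^ (k + 1) = (2⁻¹) ^ (k + 1) * 4 ^ (k + 1) := by
          rw [← mul_pow]; congr 1
          rw [show (4 : ℝ≥0∞) = 2 * 2 by norm_num, ← mul_assoc,
            ENNReal.inv_mul_cancel two_ne_zero (by simp), one_mul]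
      _ ≤ (2⁻¹) ^ (k + 1) * ∫⁻ x, F k x ∂μ := by gcongr; exact hF k
      _ = ∫⁻ x, (2⁻¹) ^ (k + 1) * F k x ∂μ := by
          rw [lintegral_const_mul' _ _ (ENNReal.pow_ne_top (by simp))]
      _ ≤ _ := lintegral_mono_ae (hle.mono fun x hx => hx k)
  have h2 : Tendsto (fun k : ℕ => (2 : ℝ≥0∞) ^ (k + 1)) atTop (𝓝 ∞) :=
    (tendsto_add_atTop_iff_nat 1).2 (ENNReal.tendsto_pow_atTop_nhds_top_iff.2 (by norm_num))
  exact top_le_iff.1 (le_of_tendsto' h2 h1)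

theorem refWeight_mem (hs : 1 ≤ s) : IsNonnegLs s (refWeight n) := by
  rw [isNonnegLs_iff (by linarith)]
  refine ⟨measurable_refWeight.aemeasurable, ?_⟩
  exact (lintegral_mono fun x => ENNReal.rpow_le_self_of_le_one (refWeight_le_one x) hs).trans_lt
    lintegral_refWeight_lt_top

theorem rieszPotential_refWeight_pos (hα : 0 < α) (hαn : α < n) (x : Rn n) :
    0 < rieszPotential α (refWeight n) x := by
  rw [rieszPotential_eq]
  refine ENNReal.mul_pos (by simpa using rieszConst_pos hα hαn) fun h0 => ?_
  rw [lintegral_eq_zero_iff' (aemeasurable_kernel_mul measurable_kernel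
    measurable_refWeight.aemeasurable x)] at h0
  obtain ⟨y, hy⟩ := h0.exists
  simp only [Pi.zero_apply, mul_eq_zero, (refWeight_pos y).ne', or_false, kernel] at hy
  rw [ENNReal.rpow_eq_zero_iff] at hy
  rcases hy with ⟨-, h⟩ | ⟨h, -⟩
  · linarith
  · exact enorm_ne_top h

/-- A strictly positive potential turns finiteness of a weighted integral into a.e. finiteness of
the other factor. -/
theorem exists_mem_lsBall_rieszPotential_pos (hs : 1 ≤ s) (hα : 0 < α) (hαn : α < n) :
    ∃ h ∈ lsBall n s, ∀ x, 0 < rieszPotential α h x := by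
  have hs0 : 0 < s := by linarith
  have hm := refWeight_mem (n := n) hs
  set c := eLpNorm (refWeight n) (ENNReal.ofReal s) volume
  have hc : c + 1 ≠ ∞ := ENNReal.add_ne_top.2 ⟨hm.2.ne, ENNReal.one_ne_top⟩
  refine ⟨_, inv_mul_mem_lsBall hs0 hm (c := c + 1) (by simp) le_self_add, fun x => ?_⟩
  rw [rieszPotential_const_mul (by simp)]
  exact ENNReal.mul_pos (ENNReal.inv_ne_zero.2 hc) (rieszPotential_refWeight_pos hα hαn x).ne'

end

/-! ### The extremal function for the N̄-norm -/

section

variable {n : ℕ} {α s r p q : ℝ}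

/-! ### Minkowski's inequality and convexity of the set of weights -/

theorem inner_le_rpow_two {ρ τ : ℝ} (h : ρ.HolderConjugate τ) (a b c d : ℝ≥0∞) :
    a * c + b * d ≤ (a ^ ρ + b ^ ρ) ^ (1 / ρ) * (c ^ τ + d ^ τ) ^ (1 / τ) := by
  have := ENNReal.inner_le_Lp_mul_Lq (Finset.univ : Finset (Fin 2)) ![a, b] ![c, d] h
  simpa [Fin.sum_univ_two] using this

/-- Minkowski's integral inequality for two functions. -/
theorem lintegral_rpow_add_le {X : Type*} [MeasurableSpace X] {μ : Measure X} {a b : X → ℝ≥0∞}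
    (ha : AEMeasurable a μ) {ρ : ℝ} (hρ : 1 ≤ ρ) :
    (∫⁻ x, a x ∂μ) ^ ρ + (∫⁻ x, b x ∂μ) ^ ρ ≤
      (∫⁻ x, (a x ^ ρ + b x ^ ρ) ^ (1 / ρ) ∂μ) ^ ρ := by
  rcases hρ.eq_or_lt with rfl | hρ1
  · simp [lintegral_add_left' ha]
  have hc := Real.HolderConjugate.conjExponent hρ1
  set τ := ρ.conjExponent
  have hρ0 := hc.pos
  have hτ0 := hc.symm.pos
  set A := ∫⁻ x, a x ∂μ
  set B := ∫⁻ x, b x ∂μ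
  set Y := ∫⁻ x, (a x ^ ρ + b x ^ ρ) ^ (1 / ρ) ∂μ
  have hAY : A ≤ Y := lintegral_mono fun x => by
    rw [one_div, ENNReal.le_rpow_inv_iff hρ0]; exact le_self_add
  have hBY : B ≤ Y := lintegral_mono fun x => by
    rw [one_div, ENNReal.le_rpow_inv_iff hρ0]; exact le_add_self
  by_cases hY : Y = ∞
  · rw [hY, ENNReal.top_rpow_of_pos hρ0]; exact le_top
  set P := A ^ ρ + B ^ ρ with hP
  have hPt : P ≠ ∞ := ENNReal.add_ne_top.2
    ⟨(ENNReal.rpow_lt_top_of_nonneg hρ0.le (ne_top_of_le_ne_top hY hAY)).ne,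
      (ENNReal.rpow_lt_top_of_nonneg hρ0.le (ne_top_of_le_ne_top hY hBY)).ne⟩
  by_cases hP0 : P = 0
  · rw [hP0]; exact zero_le
  have hAt : A ^ (ρ - 1) ≠ ∞ :=
    (ENNReal.rpow_lt_top_of_nonneg (by linarith) (ne_top_of_le_ne_top hY hAY)).ne
  have hBt : B ^ (ρ - 1) ≠ ∞ :=
    (ENNReal.rpow_lt_top_of_nonneg (by linarith) (ne_top_of_le_ne_top hY hBY)).ne
  have hself : ∀ c : ℝ≥0∞, c ^ ρ = c ^ (ρ - 1) * c := fun c => by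
    nth_rewrite 3 [← ENNReal.rpow_one c]
    rw [← ENNReal.rpow_add_of_nonneg _ _ (by linarith) zero_le_one, sub_add_cancel]
  have hPτ0 : P ^ (1 / τ) ≠ 0 := (ENNReal.rpow_pos (pos_iff_ne_zero.2 hP0) hPt).ne'
  have hPτ : P ^ (1 / τ) ≠ ∞ := (ENNReal.rpow_lt_top_of_nonneg (by positivity) hPt).ne
  have h1 : P ≤ P ^ (1 / τ) * Y := by
    -- Duality: after Hölder in two coordinates under the integral, the factor P^{1/τ} cancels,
    -- because P = P^{1/τ} P^{1/ρ}.
    calc P = A ^ (ρ - 1) * A + B ^ (ρ - 1) * B := by rw [hP, hself A, hself B]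
      _ = (∫⁻ x, A ^ (ρ - 1) * a x ∂μ) + ∫⁻ x, B ^ (ρ - 1) * b x ∂μ := by
          rw [lintegral_const_mul' _ _ hAt, lintegral_const_mul' _ _ hBt]
      _ = ∫⁻ x, A ^ (ρ - 1) * a x + B ^ (ρ - 1) * b x ∂μ :=
          (lintegral_add_left' (ha.const_mul _) _).symm
      _ ≤ ∫⁻ x, P ^ (1 / τ) * (a x ^ ρ + b x ^ ρ) ^ (1 / ρ) ∂μ := by
          refine lintegral_mono fun x => ?_
          have := inner_le_rpow_two hc.symm (A ^ (ρ - 1)) (B ^ (ρ - 1)) (a x) (b x)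
          rwa [← ENNReal.rpow_mul, ← ENNReal.rpow_mul, hc.sub_one_mul_conj] at this
      _ = _ := lintegral_const_mul' _ _ hPτ
  have h2 : P = P ^ (1 / τ) * P ^ (1 / ρ) := by
    rw [← ENNReal.rpow_add _ _ hP0 hPt, one_div, one_div, hc.symm.inv_add_inv_eq_one,
      ENNReal.rpow_one]
  have h3 := h2.ge.trans h1
  rw [ENNReal.mul_le_mul_iff_right hPτ0 hPτ, one_div, ENNReal.rpow_inv_le_iff hρ0] at h3
  exact h3

theorem rieszPotential_rpow_combination_le {f g : Rn n → ℝ≥0∞} (hf : AEMeasurable f) {ρ : ℝ}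
    (hρ : 1 ≤ ρ) {t t' : ℝ≥0∞} (ht : t ≠ ∞) (ht' : t' ≠ ∞) (x : Rn n) :
    t * rieszPotential α f x ^ ρ + t' * rieszPotential α g x ^ ρ ≤
      rieszPotential α (fun y => (t * f y ^ ρ + t' * g y ^ ρ) ^ (1 / ρ)) x ^ ρ := by
  have hρ0 : 0 < ρ := by linarith
  have key := lintegral_rpow_add_le (μ := volume)
    (a := fun y => t ^ (1 / ρ) * (kernel n α (x - y) * f y))
    (b := fun y => t' ^ (1 / ρ) * (kernel n α (x - y) * g y))
    ((aemeasurable_kernel_mul measurable_kernel hf x).const_mul _) hρ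
  have hroot : ∀ c : ℝ≥0∞, (c ^ (1 / ρ)) ^ ρ = c := fun c => by
    rw [← ENNReal.rpow_mul, one_div_mul_cancel hρ0.ne', ENNReal.rpow_one]
  have hroot' : ∀ c : ℝ≥0∞, (c ^ ρ) ^ (1 / ρ) = c := fun c => by
    rw [← ENNReal.rpow_mul, mul_one_div_cancel hρ0.ne', ENNReal.rpow_one]
  have e : ∀ y, ((t ^ (1 / ρ) * (kernel n α (x - y) * f y)) ^ ρ +
      (t' ^ (1 / ρ) * (kernel n α (x - y) * g y)) ^ ρ) ^ (1 / ρ) =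
      kernel n α (x - y) * (t * f y ^ ρ + t' * g y ^ ρ) ^ (1 / ρ) := by
    intro y
    rw [← hroot' (kernel n α (x - y)), ← ENNReal.mul_rpow_of_nonneg _ _ (by positivity), hroot']
    simp only [ENNReal.mul_rpow_of_nonneg _ _ hρ0.le, hroot]
    congr 1
    ring
  simp only [e] at key
  rw [lintegral_const_mul' _ _ (ENNReal.rpow_lt_top_of_nonneg (by positivity) ht).ne,
    lintegral_const_mul' _ _ (ENNReal.rpow_lt_top_of_nonneg (by positivity) ht').ne,
    ENNReal.mul_rpow_of_nonneg _ _ hρ0.le, ENNReal.mul_rpow_of_nonneg _ _ hρ0.le, hroot,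
    hroot] at key
  simp only [rieszPotential_eq]
  simp only [ENNReal.mul_rpow_of_nonneg _ _ hρ0.le]
  rw [mul_left_comm t, mul_left_comm t', ← mul_add]
  exact mul_le_mul' le_rfl key

/-- The witness is the weighted ρ-mean of f and g. The choice ρ = max(r, 1) meets three demands: ρ ≥
1 for Minkowski, ρ ≤ s to keep the mean in the ball, and ρ ≥ r to pass from r-th to ρ-th powers by
convexity. -/
theorem exists_mem_lsBall_combination_le (hs : 1 < s) (hr : 0 < r) (hrs : r ≤ s)
    {f g : Rn n → ℝ≥0∞} (hf : f ∈ lsBall n s) (hg : g ∈ lsBall n s) {t t' : ℝ≥0∞}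
    (htt : t + t' = 1) :
    ∃ h ∈ lsBall n s, ∀ x, t * rieszPotential α f x ^ r + t' * rieszPotential α g x ^ r ≤
      rieszPotential α h x ^ r := by
  set ρ := max r 1
  have hρ1 : 1 ≤ ρ := le_max_right _ _
  have hρr : r ≤ ρ := le_max_left _ _
  have hρs : ρ ≤ s := max_le hrs hs.le
  have hρ0 : 0 < ρ := by linarith
  have htt1 : t ≠ ∞ := ne_top_of_le_ne_top ENNReal.one_ne_top (htt ▸ le_self_add)
  have htt2 : t' ≠ ∞ := ne_top_of_le_ne_top ENNReal.one_ne_top (htt ▸ le_add_self)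
  refine ⟨fun y => (t * f y ^ ρ + t' * g y ^ ρ) ^ (1 / ρ), ⟨?_, ?_⟩, fun x => ?_⟩
  · exact (((hf.1.pow_const ρ).const_mul t).add ((hg.1.pow_const ρ).const_mul t')).pow_const _
  · calc ∫⁻ y, ((t * f y ^ ρ + t' * g y ^ ρ) ^ (1 / ρ)) ^ s
        ≤ ∫⁻ y, t * f y ^ s + t' * g y ^ s := by
          refine lintegral_mono fun y => ?_
          have := ENNReal.rpow_arith_mean_le_arith_mean2_rpow t t' (f y ^ ρ) (g y ^ ρ) htt
            ((one_le_div hρ0).2 hρs)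
          rwa [← ENNReal.rpow_mul, ← ENNReal.rpow_mul, mul_div_cancel₀ _ hρ0.ne',
            ← one_div_mul_eq_div, ENNReal.rpow_mul] at this
      _ = t * (∫⁻ y, f y ^ s) + t' * ∫⁻ y, g y ^ s := by
          rw [lintegral_add_left' ((hf.1.pow_const s).const_mul _), lintegral_const_mul' _ _ htt1,
            lintegral_const_mul' _ _ htt2]
      _ ≤ t * 1 + t' * 1 := by gcongr; exacts [hf.2, hg.2]
      _ = 1 := by rw [mul_one, mul_one, htt]
  · have h1 := ENNReal.rpow_arith_mean_le_arith_mean2_rpow t t' (rieszPotential α f x ^ r)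
      (rieszPotential α g x ^ r) htt ((one_le_div hr).2 hρr)
    rw [← ENNReal.rpow_mul, ← ENNReal.rpow_mul, mul_div_cancel₀ _ hr.ne'] at h1
    have h2 := h1.trans (rieszPotential_rpow_combination_le (g := g) hf.1 hρ1 htt1 htt2 x)
    rw [← ENNReal.rpow_le_rpow_iff (show 0 < ρ / r by positivity)]
    rwa [← ENNReal.rpow_mul _ r, mul_div_cancel₀ _ hr.ne']

/-! ### The Euler–Lagrange inequality -/

/-- Young's inequality for b^{1-q} = a^{(1-q)/q} · (a^{(q-1)/q} b^{1-q}), using (1-q)p = -q. -/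
theorem rpow_one_sub_le_young (hpq : p.HolderConjugate q) {a b : ℝ≥0∞} (ha0 : a ≠ 0) (ha : a ≠ ∞) :
    b ^ (1 - q) ≤ ENNReal.ofReal q⁻¹ * a ^ (1 - q) + ENNReal.ofReal p⁻¹ * (a * b ^ (-q)) := by
  have hp0 := hpq.pos
  have hq0 := hpq.symm.pos
  have h := ENNReal.young_inequality (a ^ ((1 - q) / q)) (a ^ ((q - 1) / q) * b ^ (1 - q)) hpq.symm
  have hmul := hpq.symm.sub_one_mul_conj
  have e1 : (q - 1) / q * p = 1 := by field_simp; linarith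
  have e2 : (1 - q) * p = -q := by linarith
  rw [← mul_assoc, ← ENNReal.rpow_add _ _ ha0 ha, ← add_div, sub_add_sub_cancel', sub_self,
    zero_div, ENNReal.rpow_zero, one_mul, ENNReal.mul_rpow_of_nonneg _ _ hp0.le,
    ← ENNReal.rpow_mul, ← ENNReal.rpow_mul, ← ENNReal.rpow_mul, div_mul_cancel₀ _ hq0.ne', e1, e2,
    ENNReal.rpow_one] at h
  rwa [ENNReal.ofReal_inv_of_pos hq0, ENNReal.ofReal_inv_of_pos hp0, ← ENNReal.div_eq_inv_mul,
    ← ENNReal.div_eq_inv_mul]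

/-- A first variation without differentiation under the integral. With b = t'a + tw, minimality
gives N ≤ Z = t'X' + tY, and Young gives Z ≤ N/q + X'/p ≤ Z/q + X'/p. Hence Z ≤ X', so Y ≤ X', and b
≥ t'a bounds X' by t'^{-q} N. -/
theorem lintegral_rpow_neg_mul_le_of_perturbation {X : Type*} [MeasurableSpace X] {μ : Measure X}
    (hpq : p.HolderConjugate q) {G a w : X → ℝ≥0∞} (hG : AEMeasurable G μ) (ha : AEMeasurable a μ)
    (hw : AEMeasurable w μ) (hat : ∀ᵐ x ∂μ, a x ≠ ∞) (ha0 : ∀ᵐ x ∂μ, G x ≠ 0 → a x ≠ 0)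
    (hwt : ∀ᵐ x ∂μ, w x ≠ ∞) (hN : ∫⁻ x, G x * a x ^ (1 - q) ∂μ ≠ ∞) {t t' : ℝ≥0∞} (ht : t ≠ 0)
    (ht' : t' ≠ 0) (htt : t + t' = 1)
    (hmin : ∫⁻ x, G x * a x ^ (1 - q) ∂μ ≤ ∫⁻ x, G x * (t' * a x + t * w x) ^ (1 - q) ∂μ) :
    ∫⁻ x, G x * (w x * (t' * a x + t * w x) ^ (-q)) ∂μ ≤
      t' ^ (-q) * ∫⁻ x, G x * a x ^ (1 - q) ∂μ := by
  have hp0 := hpq.pos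
  have hq0 := hpq.symm.pos
  have htt1 : t ≠ ∞ := ne_top_of_le_ne_top ENNReal.one_ne_top (htt ▸ le_self_add)
  have htt2 : t' ≠ ∞ := ne_top_of_le_ne_top ENNReal.one_ne_top (htt ▸ le_add_self)
  set b : X → ℝ≥0∞ := fun x => t' * a x + t * w x with hb
  have hbm : AEMeasurable b μ := (ha.const_mul _).add (hw.const_mul _)
  set N := ∫⁻ x, G x * a x ^ (1 - q) ∂μ
  set X' := ∫⁻ x, G x * (a x * b x ^ (-q)) ∂μ
  set Y := ∫⁻ x, G x * (w x * b x ^ (-q)) ∂μ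
  set Z := ∫⁻ x, G x * b x ^ (1 - q) ∂μ
  have hXN : X' ≤ t' ^ (-q) * N := by
    rw [← lintegral_const_mul' _ _ (by simp [ENNReal.rpow_eq_top_iff, ht', htt2])]
    refine lintegral_mono_ae ?_
    filter_upwards [hat, ha0] with x hx hx0
    by_cases hGx : G x = 0
    · simp [hGx]
    have hax := hx0 hGx
    rw [mul_left_comm (t' ^ (-q))]
    refine mul_le_mul' le_rfl ?_
    calc a x * b x ^ (-q) ≤ a x * (t' * a x) ^ (-q) :=
          mul_le_mul' le_rfl (ennreal_rpow_le_rpow_of_nonpos le_self_add (by linarith))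
      _ = t' ^ (-q) * (a x ^ (1 : ℝ) * a x ^ (-q)) := by
          rw [ENNReal.mul_rpow_of_ne_top htt2 hx, ENNReal.rpow_one]; ring
      _ = t' ^ (-q) * a x ^ (1 - q) := by
          rw [← ENNReal.rpow_add _ _ hax hx, sub_eq_add_neg]
  have hXt : X' ≠ ∞ := ne_top_of_le_ne_top
    (ENNReal.mul_ne_top (by simp [ENNReal.rpow_eq_top_iff, ht', htt2]) hN) hXN
  have hmX : AEMeasurable (fun x => G x * (a x * b x ^ (-q))) μ :=
    hG.mul (ha.mul (hbm.pow_const _))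
  have hZ : Z = t' * X' + t * Y := by
    rw [← lintegral_const_mul' _ _ htt2, ← lintegral_const_mul' _ _ htt1,
      ← lintegral_add_left' (hmX.const_mul _)]
    refine lintegral_congr_ae ?_
    filter_upwards [hat, ha0, hwt] with x hx hx0 hxw
    by_cases hGx : G x = 0
    · simp [hGx]
    have hb0 : b x ≠ 0 := by simp [hb, ht', hx0 hGx]
    have hbt : b x ≠ ∞ := ENNReal.add_ne_top.2 ⟨ENNReal.mul_ne_top htt2 hx,
      ENNReal.mul_ne_top htt1 hxw⟩
    calc G x * b x ^ (1 - q) = G x * (b x ^ (1 : ℝ) * b x ^ (-q)) := by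
          rw [← ENNReal.rpow_add _ _ hb0 hbt, sub_eq_add_neg]
      _ = G x * ((t' * a x + t * w x) * b x ^ (-q)) := by rw [ENNReal.rpow_one]
      _ = _ := by ring
  have hmN : AEMeasurable (fun x => G x * a x ^ (1 - q)) μ := hG.mul (ha.pow_const _)
  have hYoung : Z ≤ ENNReal.ofReal q⁻¹ * N + ENNReal.ofReal p⁻¹ * X' := by
    rw [← lintegral_const_mul' _ _ ENNReal.ofReal_ne_top,
      ← lintegral_const_mul' _ _ ENNReal.ofReal_ne_top,
      ← lintegral_add_left' (hmN.const_mul _)]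
    refine lintegral_mono_ae ?_
    filter_upwards [hat, ha0] with x hx hx0
    by_cases hGx : G x = 0
    · simp [hGx]
    calc G x * b x ^ (1 - q) ≤ G x * (ENNReal.ofReal q⁻¹ * a x ^ (1 - q) +
          ENNReal.ofReal p⁻¹ * (a x * b x ^ (-q))) :=
          mul_le_mul' le_rfl (rpow_one_sub_le_young hpq (hx0 hGx) hx)
      _ = _ := by ring
  have hZt : Z ≠ ∞ := ne_top_of_le_ne_top (ENNReal.add_ne_top.2
    ⟨ENNReal.mul_ne_top ENNReal.ofReal_ne_top hN, ENNReal.mul_ne_top ENNReal.ofReal_ne_top hXt⟩)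
    hYoung
  have hsum : ENNReal.ofReal q⁻¹ + ENNReal.ofReal p⁻¹ = 1 := by
    rw [← ENNReal.ofReal_add (by positivity) (by positivity), hpq.symm.inv_add_inv_eq_one,
      ENNReal.ofReal_one]
  have hZX : Z ≤ X' := by
    have h1 : ENNReal.ofReal q⁻¹ * Z + ENNReal.ofReal p⁻¹ * Z ≤
        ENNReal.ofReal q⁻¹ * Z + ENNReal.ofReal p⁻¹ * X' := by
      rw [← add_mul, hsum, one_mul]
      exact hYoung.trans (by gcongr)
    rw [ENNReal.add_le_add_iff_left (ENNReal.mul_ne_top ENNReal.ofReal_ne_top hZt),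
      ENNReal.mul_le_mul_iff_right (by simpa using hp0) ENNReal.ofReal_ne_top] at h1
    exact h1
  have hYX : Y ≤ X' := by
    have h1 : t' * X' + t * Y ≤ t' * X' + t * X' := by
      rw [← hZ, ← add_mul, add_comm t', htt, one_mul]; exact hZX
    rwa [ENNReal.add_le_add_iff_left (ENNReal.mul_ne_top htt2 hXt),
      ENNReal.mul_le_mul_iff_right ht htt1] at h1
  exact hYX.trans hXN

/-- The first variation inequality at a minimizer of `∫ G a^{1-q}` over a convex set. -/
theorem lintegral_mul_rpow_neg_le_of_minimizer {X : Type*} [MeasurableSpace X] {μ : Measure X}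
    (hpq : p.HolderConjugate q) {G a w : X → ℝ≥0∞} (hG : AEMeasurable G μ) (ha : AEMeasurable a μ)
    (hw : AEMeasurable w μ) (hat : ∀ᵐ x ∂μ, a x ≠ ∞) (ha0 : ∀ᵐ x ∂μ, G x ≠ 0 → a x ≠ 0)
    (hwt : ∀ᵐ x ∂μ, w x ≠ ∞) (hN : ∫⁻ x, G x * a x ^ (1 - q) ∂μ ≠ ∞)
    (hmin : ∀ t t' : ℝ≥0∞, t + t' = 1 →
      ∫⁻ x, G x * a x ^ (1 - q) ∂μ ≤ ∫⁻ x, G x * (t' * a x + t * w x) ^ (1 - q) ∂μ) :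
    ∫⁻ x, G x * (w x * a x ^ (-q)) ∂μ ≤ ∫⁻ x, G x * a x ^ (1 - q) ∂μ := by
  set N := ∫⁻ x, G x * a x ^ (1 - q) ∂μ
  -- The shift by 2 keeps t_m < 1 also for m = 0, so that 1 - t_m is nonzero; t_m → 0 and Fatou
  -- yield the claim.
  let t : ℕ → ℝ≥0∞ := fun m => ((m : ℝ≥0∞) + 2)⁻¹
  have ht0 : ∀ m, t m ≠ 0 := fun m => by simp [t, ENNReal.add_eq_top]
  have htlt : ∀ m, t m < 1 := fun m => by
    rw [ENNReal.inv_lt_one]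
    calc (1 : ℝ≥0∞) < 2 := ENNReal.one_lt_two
      _ ≤ m + 2 := le_add_self
  have htlim : Tendsto t atTop (𝓝 0) := by
    have := (tendsto_add_atTop_iff_nat 2).2 ENNReal.tendsto_inv_nat_nhds_zero
    simpa [t] using this
  have htlim' : Tendsto (fun m => 1 - t m) atTop (𝓝 1) := by
    have := ENNReal.Tendsto.sub (tendsto_const_nhds (x := (1 : ℝ≥0∞))) htlim
      (Or.inl ENNReal.one_ne_top)
    simpa using this
  have hbound : ∀ m, ∫⁻ x, G x * (w x * ((1 - t m) * a x + t m * w x) ^ (-q)) ∂μ ≤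
      (1 - t m) ^ (-q) * N := fun m =>
    lintegral_rpow_neg_mul_le_of_perturbation hpq hG ha hw hat ha0 hwt hN (ht0 m)
      (tsub_pos_of_lt (htlt m)).ne' (add_tsub_cancel_of_le (htlt m).le)
      (hmin _ _ (add_tsub_cancel_of_le (htlt m).le))
  calc ∫⁻ x, G x * (w x * a x ^ (-q)) ∂μ
      ≤ ∫⁻ x, liminf (fun m => G x * (w x * ((1 - t m) * a x + t m * w x) ^ (-q))) atTop ∂μ := by
        refine lintegral_mono_ae ?_
        filter_upwards [hat, ha0, hwt] with x hx hx0 hxw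
        by_cases hGx : G x = 0
        · simp [hGx]
        have h1 : Tendsto (fun m => (1 - t m) * a x + t m * w x) atTop (𝓝 (a x)) := by
          have := (ENNReal.Tendsto.mul_const htlim' (Or.inr hx)).add
            (ENNReal.Tendsto.mul_const htlim (Or.inr hxw))
          simpa using this
        have h2 : Tendsto (fun m => ((1 - t m) * a x + t m * w x) ^ (-q)) atTop
            (𝓝 (a x ^ (-q))) := ((ENNReal.continuous_rpow_const (y := -q)).tendsto _).comp h1
        have hne : a x ^ (-q) ≠ 0 := (ENNReal.rpow_pos (pos_iff_ne_zero.2 (hx0 hGx)) hx).ne'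
        have h3 := ENNReal.Tendsto.const_mul (a := G x * w x) h2 (Or.inl hne)
        simp only [mul_assoc] at h3
        exact h3.liminf_eq.ge
    _ ≤ liminf (fun m => ∫⁻ x, G x * (w x * ((1 - t m) * a x + t m * w x) ^ (-q)) ∂μ) atTop :=
        lintegral_liminf_le' fun m => hG.mul
          (hw.mul (((ha.const_mul _).add (hw.const_mul _)).pow_const _))
    _ ≤ liminf (fun m => (1 - t m) ^ (-q) * N) atTop :=
        liminf_le_liminf (Eventually.of_forall hbound)
    _ = N := by
        have h1 : Tendsto (fun m => (1 - t m) ^ (-q)) atTop (𝓝 1) := by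
          have := ((ENNReal.continuous_rpow_const (y := -q)).tendsto _).comp htlim'
          simpa [Function.comp_def] using this
        have h2 := ENNReal.Tendsto.mul_const (b := N) h1 (Or.inl one_ne_zero)
        rw [one_mul] at h2
        exact h2.liminf_eq

theorem exists_mNorm_le_one_nBarNorm_le (hs : 1 < s) (hα : 0 < α) (hαn : α < (n : ℝ) / s)
    (hr : 0 < r) (hrs : r ≤ s) (hpq : p.HolderConjugate q) {g : Rn n → ℝ} (hg : AEMeasurable g)
    (hN : nBarNorm α s r q g ≠ ∞) (hN0 : nBarNorm α s r q g ≠ 0) :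
    ∃ f : Rn n → ℝ, AEMeasurable f ∧ mNorm α s p r f ≤ 1 ∧
      nBarNorm α s r q g ≤ ∫⁻ x, ‖f x * g x‖ₑ := by
  have hs0 : 0 < s := by linarith
  have hp0 := hpq.pos
  have hq0 := hpq.symm.pos
  have hq1 := hpq.symm.lt
  set N := nBarNorm α s r q g
  have hNq : ∀ {h}, h ∈ lsBall n s →
      N ^ q ≤ ∫⁻ x, ‖g x‖ₑ ^ q * (rieszPotential α h x ^ r) ^ (1 - q) := fun hh => by
    rw [← ENNReal.le_rpow_inv_iff hq0, ← one_div]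
    exact nBarNorm_le_of_mem_lsBall hs hα hαn hr hrs hh g
  obtain ⟨h₀, hh₀, hle⟩ := exists_mem_lsBall_lintegral_le_rpow hs hα hαn hr hq1
    (g := fun _ => g) (fun _ => hg) (fun x => monotone_const) (fun x => tendsto_const_nhds) hN
    (fun _ => le_rfl)
  have hNeq := le_antisymm hle (hNq hh₀)
  obtain ⟨a, hadef⟩ : ∃ a : Rn n → ℝ≥0∞, ∀ x, rieszPotential α h₀ x ^ r = a x :=
    ⟨_, fun _ => rfl⟩
  simp only [hadef] at hNeq
  have ham : AEMeasurable a := by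
    rw [← funext hadef]; exact ((measurable_rieszPotential hh₀.1).pow_const r).aemeasurable
  have hNqt : N ^ q ≠ ∞ := (ENNReal.rpow_lt_top_of_nonneg hq0.le hN).ne
  have hNq0 : N ^ q ≠ 0 := (ENNReal.rpow_pos (pos_iff_ne_zero.2 hN0) hN).ne'
  have hfin : ∀ {h}, h ∈ lsBall n s → ∀ᵐ x, rieszPotential α h x ^ r ≠ ∞ := fun hh => by
    filter_upwards [ae_rieszPotential_ne_top hs hα hαn hh] with x hx
    exact (ENNReal.rpow_lt_top_of_nonneg hr.le hx).ne
  have hat : ∀ᵐ x, a x ≠ ∞ := by simpa only [hadef] using hfin hh₀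
  have hGm : AEMeasurable fun x => ‖g x‖ₑ ^ q := hg.enorm.pow_const q
  have ha0 : ∀ᵐ x, ‖g x‖ₑ ^ q ≠ 0 → a x ≠ 0 := by
    filter_upwards [ae_lt_top' (hGm.mul (ham.pow_const (1 - q)))
      (by simp only [Pi.mul_apply]; rw [hNeq]; exact hNqt)] with x hx hGx h0
    rw [Pi.mul_apply, h0, ENNReal.zero_rpow_of_neg (by linarith), ENNReal.mul_top hGx] at hx
    exact lt_irrefl _ hx
  have hEL : ∀ h ∈ lsBall n s,
      ∫⁻ x, ‖g x‖ₑ ^ q * (rieszPotential α h x ^ r * a x ^ (-q)) ≤ N ^ q := by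
    intro h hh
    have := lintegral_mul_rpow_neg_le_of_minimizer hpq hGm ham
      ((measurable_rieszPotential (α := α) hh.1).pow_const r).aemeasurable hat ha0 (hfin hh)
      -- A convex combination of the two weights is dominated by an admissible one, so it cannot
      -- beat the minimum N^q.
      (by rw [hNeq]; exact hNqt) (fun t t' htt => by
        obtain ⟨H, hH, hHle⟩ := exists_mem_lsBall_combination_le (α := α) hs hr hrs hh hh₀ htt
        rw [hNeq]
        refine (hNq hH).trans (lintegral_mono fun x => mul_le_mul' le_rfl ?_)
        refine ennreal_rpow_le_rpow_of_nonpos ?_ (by linarith)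
        rw [← hadef, add_comm]
        exact hHle x)
    rwa [hNeq] at this
  have hNc : (N ^ (q - 1))⁻¹ ≠ ∞ :=
    ENNReal.inv_ne_top.2 (ENNReal.rpow_pos (pos_iff_ne_zero.2 hN0) hN).ne'
  -- The p-th power is N^{-q} |g|^q a^{-q}, so the trace inequality with constant 1 for this
  -- function is precisely `hEL`.
  let e : Rn n → ℝ≥0∞ := fun x => (N ^ (q - 1))⁻¹ * (‖g x‖ₑ ^ (q - 1) * a x ^ (1 - q))
  have hem : AEMeasurable e := ((hg.enorm.pow_const _).mul (ham.pow_const _)).const_mul _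
  have hfe : ∀ᵐ x, ‖(e x).toReal‖ₑ = e x := by
    filter_upwards [ha0] with x hx0
    rw [Real.enorm_of_nonneg ENNReal.toReal_nonneg, ENNReal.ofReal_toReal]
    refine ENNReal.mul_ne_top hNc ?_
    by_cases hgx : ‖g x‖ₑ = 0
    · simp [hgx, hq1]
    · have hax : a x ≠ 0 := hx0 (ENNReal.rpow_pos (pos_iff_ne_zero.2 hgx) enorm_ne_top).ne'
      refine ENNReal.mul_ne_top
        (ENNReal.rpow_lt_top_of_nonneg (by linarith) enorm_ne_top).ne ?_
      simp [ENNReal.rpow_eq_top_iff, hax, hq1.le]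
  have hqp : (q - 1) * p = q := hpq.symm.sub_one_mul_conj
  have hqp' : (1 - q) * p = -q := by linarith
  refine ⟨fun x => (e x).toReal, hem.ennreal_toReal, ?_, ?_⟩
  · have := (mNorm_le_iff (α := α) hs0 hr hp0 (f := fun x => (e x).toReal) (C := 1)).2
    rw [ENNReal.coe_one] at this
    refine this fun h hh => ?_
    rw [ENNReal.one_rpow]
    calc ∫⁻ x, rieszPotential α h x ^ r * ‖(e x).toReal‖ₑ ^ p
        = ∫⁻ x, (N ^ q)⁻¹ * (‖g x‖ₑ ^ q * (rieszPotential α h x ^ r * a x ^ (-q))) := by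
          refine lintegral_congr_ae ?_
          filter_upwards [hfe] with x hx
          rw [hx]
          simp only [e]
          rw [ENNReal.mul_rpow_of_nonneg _ _ hp0.le, ENNReal.mul_rpow_of_nonneg _ _ hp0.le,
            ENNReal.inv_rpow, ← ENNReal.rpow_mul, ← ENNReal.rpow_mul, ← ENNReal.rpow_mul, hqp, hqp']
          ring
      _ = (N ^ q)⁻¹ * ∫⁻ x, ‖g x‖ₑ ^ q * (rieszPotential α h x ^ r * a x ^ (-q)) :=
          lintegral_const_mul' _ _ (ENNReal.inv_ne_top.2 hNq0)
      _ ≤ (N ^ q)⁻¹ * N ^ q := mul_le_mul' le_rfl (hEL h hh)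
      _ = 1 := ENNReal.inv_mul_cancel hNq0 hNqt
  · refine le_of_eq ?_
    symm
    calc ∫⁻ x, ‖(e x).toReal * g x‖ₑ
        = ∫⁻ x, (N ^ (q - 1))⁻¹ * (‖g x‖ₑ ^ q * a x ^ (1 - q)) := by
          refine lintegral_congr_ae ?_
          filter_upwards [hfe] with x hx
          rw [enorm_mul, hx]
          have : ‖g x‖ₑ ^ q = ‖g x‖ₑ ^ (q - 1) * ‖g x‖ₑ := by
            nth_rewrite 3 [← ENNReal.rpow_one ‖g x‖ₑ]
            rw [← ENNReal.rpow_add_of_nonneg _ _ (by linarith) zero_le_one, sub_add_cancel]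
          rw [this]
          simp only [e]
          ring
      _ = (N ^ (q - 1))⁻¹ * N ^ q := by rw [lintegral_const_mul' _ _ hNc, hNeq]
      _ = N := by
          rw [← ENNReal.rpow_neg, ← ENNReal.rpow_add _ _ hN0 hN]
          ring_nf
          exact ENNReal.rpow_one N

end

/-! ### Köthe duals: finite norms and norm identities -/

section

variable {n : ℕ} {α s r p q : ℝ}

/-! ### Finiteness of the Köthe dual norms -/

theorem inv_two_pow_succ_rpow_le {ρ : ℝ} (hρ : 1 ≤ ρ) (k : ℕ) :
    ((2⁻¹ : ℝ≥0∞) ^ (k + 1)) ^ ρ ≤ 2⁻¹ ^ (k + 1) :=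
  ENNReal.rpow_le_self_of_le_one (pow_le_one' (by simp) _) hρ

/-- Gliding hump: if unit-ball elements f_k had pairings at least 4^{k+1}, the ℓ^p sum of 2^{-k-1}
f_k would still lie in the unit ball of M, yet its pairing with g would be infinite. -/
theorem kotheDualNorm_mSpace_lt_top (hs : 1 < s) (hα : 0 < α) (hαn : α < (n : ℝ) / s)
    (hr : 0 < r) (hp : 1 < p) {g : Rn n → ℝ} (hg : g ∈ kotheDual (mSpace n α s p r)) :
    kotheDualNorm (mSpace n α s p r) (mNorm α s p r) g < ∞ := by
  have hs0 : 0 < s := by linarith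
  have hp0 : 0 < p := by linarith
  by_contra htop
  rw [not_lt, top_le_iff] at htop
  have hex : ∀ k : ℕ, ∃ f ∈ mSpace n α s p r, mNorm α s p r f ≤ 1 ∧
      (4 : ℝ≥0∞) ^ (k + 1) ≤ ∫⁻ x, ‖f x * g x‖ₑ := by
    intro k
    have : (4 : ℝ≥0∞) ^ (k + 1) < kotheDualNorm (mSpace n α s p r) (mNorm α s p r) g := by
      rw [htop]; exact ENNReal.pow_lt_top (by simp)
    simp only [kotheDualNorm, lt_iSup_iff] at this
    obtain ⟨f, h1, h2, h3⟩ := this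
    exact ⟨f, h1, h2, h3.le⟩
  choose f hf hf1 hfg using hex
  have hfm : ∀ k, AEMeasurable (f k) := fun k => (hf k).1
  have hsum : ∀ h ∈ lsBall n s, ∫⁻ x, rieszPotential α h x ^ r *
      ∑' k : ℕ, ((2⁻¹ : ℝ≥0∞) ^ (k + 1)) ^ p * ‖f k x‖ₑ ^ p ≤ 1 := by
    intro h hh
    have hhm : Measurable fun x => rieszPotential α h x ^ r :=
      (measurable_rieszPotential hh.1).pow_const r
    simp only [← ENNReal.tsum_mul_left]
    have hterm : ∀ k, AEMeasurable fun x => rieszPotential α h x ^ r *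
        (((2⁻¹ : ℝ≥0∞) ^ (k + 1)) ^ p * ‖f k x‖ₑ ^ p) := fun k =>
      hhm.aemeasurable.mul (((hfm k).enorm.pow_const p).const_mul _)
    rw [lintegral_tsum hterm]
    refine le_trans (ENNReal.tsum_le_tsum fun k => ?_) tsum_inv_two_pow_succ.le
    have h1 := (mNorm_le_iff hs0 hr hp0 (C := 1)).1 (by simpa using hf1 k) h hh
    rw [ENNReal.coe_one, ENNReal.one_rpow] at h1
    have hc := inv_two_pow_succ_rpow_le hp.le k
    calc ∫⁻ x, rieszPotential α h x ^ r * (((2⁻¹ : ℝ≥0∞) ^ (k + 1)) ^ p * ‖f k x‖ₑ ^ p)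
        = ((2⁻¹ : ℝ≥0∞) ^ (k + 1)) ^ p * ∫⁻ x, rieszPotential α h x ^ r * ‖f k x‖ₑ ^ p := by
          rw [← lintegral_const_mul' _ _ (ENNReal.rpow_lt_top_of_nonneg hp0.le
            (ENNReal.pow_ne_top (by simp))).ne]
          exact lintegral_congr fun x => by ring
      _ ≤ 2⁻¹ ^ (k + 1) * 1 := mul_le_mul' hc h1
      _ = _ := mul_one _
  have hfin : ∀ᵐ x, ∑' k : ℕ, ((2⁻¹ : ℝ≥0∞) ^ (k + 1)) ^ p * ‖f k x‖ₑ ^ p ≠ ∞ := by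
    obtain ⟨h, hh, hpos⟩ := exists_mem_lsBall_rieszPotential_pos hs.le hα
      (lt_natCast_of_lt_div hs hαn)
    have hm : AEMeasurable fun x => rieszPotential α h x ^ r *
        ∑' k : ℕ, ((2⁻¹ : ℝ≥0∞) ^ (k + 1)) ^ p * ‖f k x‖ₑ ^ p :=
      ((measurable_rieszPotential hh.1).pow_const r).aemeasurable.mul
        (AEMeasurable.tsum fun k => ((hfm k).enorm.pow_const p).const_mul _)
    filter_upwards [ae_lt_top' hm ((hsum h hh).trans_lt ENNReal.one_lt_top).ne] with x hx h0
    rw [h0, ENNReal.mul_top (ENNReal.rpow_pos_of_nonneg (hpos x) hr.le).ne'] at hx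
    exact lt_irrefl _ hx
  obtain ⟨f₀, hf₀m, hf₀le, hf₀ge⟩ := exists_real_dominating hp0 hfm hfin
  have hf₀ : f₀ ∈ mSpace n α s p r := by
    refine (mem_mSpace_iff hs hα hαn hr hp0).2 ⟨hf₀m,
      lt_of_le_of_lt ?_ (ENNReal.coe_lt_top (r := 1))⟩
    refine (mNorm_le_iff hs0 hr hp0).2 fun h hh => ?_
    rw [ENNReal.coe_one, ENNReal.one_rpow]
    exact (lintegral_mono fun x => mul_le_mul' le_rfl (hf₀le x)).trans (hsum h hh)
  have h1 := lintegral_eq_top_of_hump (μ := volume) (F := fun k x => ‖f k x * g x‖ₑ)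
    (F₀ := fun x => ‖f₀ x * g x‖ₑ) (by
      filter_upwards [hf₀ge] with x hx k
      rw [enorm_mul, enorm_mul, ← mul_assoc]
      exact mul_le_mul' (hx k) le_rfl) hfg
  exact (hasFiniteIntegral_iff_enorm.1 (hg.2 f₀ hf₀).2).ne h1

/-- The weighted ℓ^s sum of the h_k stays in the ball because the weights 2^{-k-1} add up to 1. It
provides one weight serving a whole sequence of elements of N̄. -/
theorem exists_mem_lsBall_forall_le (hs : 1 ≤ s) {h : ℕ → Rn n → ℝ≥0∞}
    (hh : ∀ k, h k ∈ lsBall n s) :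
    ∃ h₀ ∈ lsBall n s, ∀ k x, ((2⁻¹ : ℝ≥0∞) ^ (k + 1)) ^ (1 / s) * rieszPotential α (h k) x ≤
      rieszPotential α h₀ x := by
  have hs0 : 0 < s := by linarith
  refine ⟨fun x => (∑' k : ℕ, (2⁻¹ : ℝ≥0∞) ^ (k + 1) * h k x ^ s) ^ (1 / s), ⟨?_, ?_⟩, ?_⟩
  · exact (AEMeasurable.tsum fun k => ((hh k).1.pow_const s).const_mul _).pow_const _
  · simp only [← ENNReal.rpow_mul, one_div_mul_cancel hs0.ne', ENNReal.rpow_one]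
    rw [lintegral_tsum fun k => ((hh k).1.pow_const s).const_mul _]
    refine le_trans (ENNReal.tsum_le_tsum fun k => ?_) tsum_inv_two_pow_succ.le
    rw [lintegral_const_mul' _ _ (ENNReal.pow_ne_top (by simp))]
    exact (mul_le_mul' le_rfl (hh k).2).trans (mul_one _).le
  · intro k x
    rw [← rieszPotential_const_mul
      (ENNReal.rpow_lt_top_of_nonneg (by positivity) (ENNReal.pow_ne_top (by simp))).ne]
    refine rieszPotential_mono_ae (Eventually.of_forall fun y => ?_) x
    rw [one_div, ENNReal.le_rpow_inv_iff hs0, ENNReal.mul_rpow_of_nonneg _ _ hs0.le,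
      ← ENNReal.rpow_mul, inv_mul_cancel₀ hs0.ne', ENNReal.rpow_one]
    exact ENNReal.le_tsum (f := fun k : ℕ => (2⁻¹ : ℝ≥0∞) ^ (k + 1) * h k y ^ s) k

/-- The same gliding hump, after the optimal weights of the g_k have been replaced by a common one.
-/
theorem kotheDualNorm_nBarSpace_lt_top (hs : 1 < s) (hα : 0 < α) (hαn : α < (n : ℝ) / s)
    (hr : 0 < r) (hrs : r ≤ s) (hq : 1 < q) {f : Rn n → ℝ}
    (hf : f ∈ kotheDual (nBarSpace n α s r q)) :
    kotheDualNorm (nBarSpace n α s r q) (nBarNorm α s r q) f < ∞ := by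
  have hs0 : 0 < s := by linarith
  have hq0 : 0 < q := by linarith
  by_contra htop
  rw [not_lt, top_le_iff] at htop
  have hex : ∀ k : ℕ, ∃ g : Rn n → ℝ, AEMeasurable g ∧ (∃ h ∈ lsBall n s,
      ∫⁻ x, ‖g x‖ₑ ^ q * (rieszPotential α h x ^ r) ^ (1 - q) ≤ 1) ∧
      (4 : ℝ≥0∞) ^ (k + 1) ≤ ∫⁻ x, ‖g x * f x‖ₑ := by
    intro k
    have : (4 : ℝ≥0∞) ^ (k + 1) < kotheDualNorm (nBarSpace n α s r q) (nBarNorm α s r q) f := by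
      rw [htop]; exact ENNReal.pow_lt_top (by simp)
    simp only [kotheDualNorm, lt_iSup_iff] at this
    obtain ⟨g, h1, h2, h3⟩ := this
    refine ⟨g, h1.1, ?_, h3.le⟩
    have := exists_mem_lsBall_lintegral_le_rpow hs hα hαn hr hq (g := fun _ => g) (fun _ => h1.1)
      (fun x => monotone_const) (fun x => tendsto_const_nhds) ENNReal.one_ne_top (fun _ => h2)
    simpa using this
  choose g hgm hgh hgf using hex
  choose h hh hgint using hgh
  obtain ⟨h₀, hh₀, hle⟩ := exists_mem_lsBall_forall_le (α := α) hs.le hh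
  have hw₀m : Measurable fun x => (rieszPotential α h₀ x ^ r) ^ (1 - q) :=
    ((measurable_rieszPotential hh₀.1).pow_const r).pow_const _
  have hsum : ∫⁻ x, (∑' k : ℕ, ((2⁻¹ : ℝ≥0∞) ^ (k + 1)) ^ q * ‖g k x‖ₑ ^ q) *
      (rieszPotential α h₀ x ^ r) ^ (1 - q) ≤ 1 := by
    simp only [← ENNReal.tsum_mul_right]
    have hterm : ∀ k, AEMeasurable fun x => ((2⁻¹ : ℝ≥0∞) ^ (k + 1)) ^ q * ‖g k x‖ₑ ^ q *
        (rieszPotential α h₀ x ^ r) ^ (1 - q) := fun k =>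
      (((hgm k).enorm.pow_const q).const_mul _).mul hw₀m.aemeasurable
    rw [lintegral_tsum hterm]
    refine le_trans (ENNReal.tsum_le_tsum fun k => ?_) tsum_inv_two_pow_succ.le
    set c : ℝ≥0∞ := 2⁻¹ ^ (k + 1)
    have hc0 : c ≠ 0 := (ENNReal.pow_pos (by simp) _).ne'
    have hc1 : c ≤ 1 := pow_le_one' (by simp) _
    have hct : c ≠ ∞ := ne_top_of_le_ne_top ENNReal.one_ne_top hc1
    -- The common weight costs c^{(r/s)(1-q)}; as r ≤ s, the total exponent q - (q-1)r/s is at least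
    -- 1.
    have hcc : c ^ q * (c ^ (r / s)) ^ (1 - q) ≤ c := by
      rw [← ENNReal.rpow_mul, ← ENNReal.rpow_add _ _ hc0 hct]
      refine ENNReal.rpow_le_self_of_le_one hc1 ?_
      have : r / s ≤ 1 := (div_le_one hs0).2 hrs
      nlinarith
    calc ∫⁻ x, c ^ q * ‖g k x‖ₑ ^ q * (rieszPotential α h₀ x ^ r) ^ (1 - q)
        ≤ ∫⁻ x, c * (‖g k x‖ₑ ^ q * (rieszPotential α (h k) x ^ r) ^ (1 - q)) := by
          refine lintegral_mono fun x => ?_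
          have h1 : c ^ (r / s) * rieszPotential α (h k) x ^ r ≤ rieszPotential α h₀ x ^ r := by
            have := ENNReal.rpow_le_rpow (hle k x) hr.le
            rwa [ENNReal.mul_rpow_of_nonneg _ _ hr.le, ← ENNReal.rpow_mul, one_div_mul_eq_div]
              at this
          have h2 := ennreal_rpow_le_rpow_of_nonpos h1 (z := 1 - q) (by linarith)
          rw [ennreal_mul_rpow_of_neg
            (ENNReal.rpow_pos (pos_iff_ne_zero.2 hc0) hct).ne'
            (ENNReal.rpow_lt_top_of_nonneg (by positivity) hct).ne (by linarith)] at h2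
          calc c ^ q * ‖g k x‖ₑ ^ q * (rieszPotential α h₀ x ^ r) ^ (1 - q)
              ≤ c ^ q * ‖g k x‖ₑ ^ q *
                ((c ^ (r / s)) ^ (1 - q) * (rieszPotential α (h k) x ^ r) ^ (1 - q)) :=
                mul_le_mul' le_rfl h2
            _ = c ^ q * (c ^ (r / s)) ^ (1 - q) *
                (‖g k x‖ₑ ^ q * (rieszPotential α (h k) x ^ r) ^ (1 - q)) := by ring
            _ ≤ _ := mul_le_mul' hcc le_rfl
      _ ≤ c := by
          rw [lintegral_const_mul' _ _ hct]
          exact (mul_le_mul' le_rfl (hgint k)).trans (mul_one _).le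
  have hfin : ∀ᵐ x, ∑' k : ℕ, ((2⁻¹ : ℝ≥0∞) ^ (k + 1)) ^ q * ‖g k x‖ₑ ^ q ≠ ∞ := by
    have hm : AEMeasurable fun x =>
        (∑' k : ℕ, ((2⁻¹ : ℝ≥0∞) ^ (k + 1)) ^ q * ‖g k x‖ₑ ^ q) *
          (rieszPotential α h₀ x ^ r) ^ (1 - q) :=
      (AEMeasurable.tsum fun k => ((hgm k).enorm.pow_const q).const_mul _).mul hw₀m.aemeasurable
    filter_upwards [ae_lt_top' hm (hsum.trans_lt ENNReal.one_lt_top).ne,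
      ae_rieszPotential_ne_top hs hα hαn hh₀] with x hx hx0 h0
    have hne : (rieszPotential α h₀ x ^ r) ^ (1 - q) ≠ 0 := by
      have := (ENNReal.rpow_lt_top_of_nonneg hr.le hx0).ne
      simp [ENNReal.rpow_eq_zero_iff, this, hq.le, hx0, hr]
    rw [h0, ENNReal.top_mul hne] at hx
    exact lt_irrefl _ hx
  obtain ⟨g₀, hg₀m, hg₀le, hg₀ge⟩ := exists_real_dominating hq0 hgm hfin
  have hg₀ : g₀ ∈ nBarSpace n α s r q := by
    refine ⟨hg₀m, (nBarNorm_le_of_mem_lsBall hs hα hαn hr hrs hh₀ g₀).trans_lt ?_⟩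
    refine ENNReal.rpow_lt_top_of_nonneg (by positivity) (ne_top_of_le_ne_top ENNReal.one_ne_top ?_)
    exact (lintegral_mono fun x => mul_le_mul' (hg₀le x) le_rfl).trans hsum
  have h1 := lintegral_eq_top_of_hump (μ := volume) (F := fun k x => ‖g k x * f x‖ₑ)
    (F₀ := fun x => ‖g₀ x * f x‖ₑ) (by
      filter_upwards [hg₀ge] with x hx k
      rw [enorm_mul, enorm_mul, ← mul_assoc]
      exact mul_le_mul' (hx k) le_rfl) hgf
  exact (hasFiniteIntegral_iff_enorm.1 (hf.2 g₀ hg₀).2).ne h1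

/-! ### Equality of the norms -/

theorem le_kotheDualNorm {X : Set (Rn n → ℝ)} {N : (Rn n → ℝ) → ℝ≥0∞} {f : Rn n → ℝ}
    (hf : f ∈ X) (hf1 : N f ≤ 1) (g : Rn n → ℝ) : ∫⁻ x, ‖f x * g x‖ₑ ≤ kotheDualNorm X N g :=
  le_iSup_of_le f (le_iSup_of_le hf (le_iSup_of_le hf1 le_rfl))

theorem kotheDualNorm_mono {X : Set (Rn n → ℝ)} {N : (Rn n → ℝ) → ℝ≥0∞} {g g' : Rn n → ℝ}
    (h : ∀ x, ‖g x‖ₑ ≤ ‖g' x‖ₑ) : kotheDualNorm X N g ≤ kotheDualNorm X N g' := by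
  refine iSup_mono fun f => iSup_mono fun _ => iSup_mono fun _ => lintegral_mono fun x => ?_
  rw [enorm_mul, enorm_mul]
  exact mul_le_mul' le_rfl (h x)

theorem nBarNorm_le_kotheDualNorm_of_ne_top (hs : 1 < s) (hα : 0 < α) (hαn : α < (n : ℝ) / s)
    (hr : 0 < r) (hrs : r ≤ s) (hpq : p.HolderConjugate q) {g : Rn n → ℝ} (hg : AEMeasurable g)
    (hN : nBarNorm α s r q g ≠ ∞) :
    nBarNorm α s r q g ≤ kotheDualNorm (mSpace n α s p r) (mNorm α s p r) g := by
  by_cases hN0 : nBarNorm α s r q g = 0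
  · rw [hN0]; exact zero_le
  obtain ⟨f, hf, hf1, hle⟩ := exists_mNorm_le_one_nBarNorm_le hs hα hαn hr hrs hpq hg hN hN0
  exact hle.trans (le_kotheDualNorm
    ((mem_mSpace_iff hs hα hαn hr hpq.pos).2 ⟨hf, hf1.trans_lt ENNReal.one_lt_top⟩) hf1 g)

/-- The truncation is bounded with bounded support, and some normalized potential is bounded below
on that support. -/
theorem nBarNorm_truncSet_indicator_ne_top (hs : 1 < s) (hα : 0 < α) (hαn : α < (n : ℝ) / s)
    (hr : 0 < r) (hrs : r ≤ s) (hq : 1 < q) (g : Rn n → ℝ) (k : ℕ) :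
    nBarNorm α s r q ((truncSet g k).indicator g) ≠ ∞ := by
  have hs0 : 0 < s := by linarith
  have hq0 : 0 < q := by linarith
  obtain ⟨h, hm, hhs, c, hc0, hle⟩ := exists_rieszPotential_ge hα (lt_natCast_of_lt_div hs hαn) hs0
    (isCompact_closedBall (0 : Rn n) k)
  have hh : IsNonnegLs s h := (isNonnegLs_iff hs0).2 ⟨hm.aemeasurable, hhs⟩
  set d := eLpNorm h (ENNReal.ofReal s) volume + 1
  have hdt : d ≠ ∞ := ENNReal.add_ne_top.2 ⟨hh.2.ne, ENNReal.one_ne_top⟩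
  have hball := inv_mul_mem_lsBall hs0 hh (c := d) (by simp [d]) le_self_add
  set c' := d⁻¹ * c
  have hc' : c' ≠ 0 := mul_ne_zero (ENNReal.inv_ne_zero.2 hdt) hc0.ne'
  have hD : (c' ^ r) ^ (1 - q) < ∞ := by
    rw [lt_top_iff_ne_top]
    have : c' ^ r ≠ 0 := (ENNReal.rpow_pos_of_nonneg (pos_iff_ne_zero.2 hc') hr.le).ne'
    simp [ENNReal.rpow_eq_top_iff, this, hq.le]
  refine ((nBarNorm_le_of_mem_lsBall hs hα hαn hr hrs hball _).trans_lt
    (ENNReal.rpow_lt_top_of_nonneg (by positivity) (ne_of_lt ?_))).ne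
  refine lt_of_le_of_lt (lintegral_mono fun x => ?_) (lintegral_truncSet_lt_top (f := g) (k := k)
    (p := q) hq0.le (w := fun _ => (c' ^ r) ^ (1 - q)) ?_)
  · by_cases hx : x ∈ truncSet g k
    · rw [Set.indicator_of_mem hx, Set.indicator_of_mem hx, mul_comm]
      refine mul_le_mul' (ennreal_rpow_le_rpow_of_nonpos (ENNReal.rpow_le_rpow ?_ hr.le)
        (by linarith)) le_rfl
      rw [rieszPotential_const_mul (by simp [d])]
      exact mul_le_mul' le_rfl (hle x (truncSet_subset_closedBall g k hx))
    · simp [hx, hq0]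
  · rw [setLIntegral_const]
    exact ENNReal.mul_lt_top hD measure_closedBall_lt_top

/-- The extremal function is available only for finite N̄-norm. It is applied to truncations of g,
and the Fatou property of `nBarNorm` carries the bound over to g, so finiteness is a conclusion
rather than an assumption. -/
theorem nBarNorm_eq_kotheDualNorm (hs : 1 < s) (hα : 0 < α) (hαn : α < (n : ℝ) / s)
    (hr : 0 < r) (hrs : r ≤ s) (hpq : p.HolderConjugate q) {g : Rn n → ℝ} (hg : AEMeasurable g) :
    nBarNorm α s r q g = kotheDualNorm (mSpace n α s p r) (mNorm α s p r) g := by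
  have hq0 := hpq.symm.pos
  apply le_antisymm
  · by_cases hA : kotheDualNorm (mSpace n α s p r) (mNorm α s p r) g = ∞
    · rw [hA]; exact le_top
    have hle : ∀ k x, ‖(truncSet g k).indicator g x‖ₑ ≤ ‖g x‖ₑ := fun k x =>
      enorm_indicator_le_enorm_self _ _
    have hgk : ∀ k, AEMeasurable ((truncSet g k).indicator g) := fun k =>
      hg.indicator₀ (nullMeasurableSet_truncSet hg k)
    obtain ⟨h, hh, hint⟩ := exists_mem_lsBall_lintegral_le_rpow hs hα hαn hr hpq.symm.lt
      (g := fun k => (truncSet g k).indicator g) (g₀ := g) hgk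
      (fun x i j hij => by
        simp only [enorm_indicator_eq_indicator_enorm]
        exact Set.indicator_le_indicator_of_subset (truncSet_mono g hij) (fun _ => zero_le) x)
      (fun x => by
        refine tendsto_const_nhds.congr' ?_
        filter_upwards [eventually_mem_truncSet g x] with k hk
        rw [Set.indicator_of_mem hk])
      hA (fun k => (nBarNorm_le_kotheDualNorm_of_ne_top hs hα hαn hr hrs hpq (hgk k)
        (nBarNorm_truncSet_indicator_ne_top hs hα hαn hr hrs hpq.symm.lt g k)).trans
          (kotheDualNorm_mono (hle k)))
    refine (nBarNorm_le_of_mem_lsBall hs hα hαn hr hrs hh g).trans ?_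
    rwa [one_div, ENNReal.rpow_inv_le_iff hq0]
  · refine iSup_le fun f => iSup_le fun hf => iSup_le fun hf1 => ?_
    by_cases hN : nBarNorm α s r q g = ∞
    · rw [hN]; exact le_top
    · simpa using lintegral_enorm_mul_le hs hα hαn hr hpq hf.1 hg (C := 1) (by simpa using hf1) hN

theorem kotheDualNorm_eq_mNorm (hs : 1 < s) (hα : 0 < α) (hαn : α < (n : ℝ) / s)
    (hr : 0 < r) (hrs : r ≤ s) (hpq : p.HolderConjugate q) {f : Rn n → ℝ} (hf : AEMeasurable f) :
    kotheDualNorm (nBarSpace n α s r q) (nBarNorm α s r q) f = mNorm α s p r f := by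
  have hs0 : 0 < s := by linarith
  apply le_antisymm
  · by_cases hC : mNorm α s p r f = ∞
    · rw [hC]; exact le_top
    refine iSup_le fun g => iSup_le fun hg => iSup_le fun hg1 => ?_
    have := lintegral_enorm_mul_le hs hα hαn hr hpq hf hg.1 (C := (mNorm α s p r f).toNNReal)
      (by rw [ENNReal.coe_toNNReal hC]) hg.2.ne
    rw [ENNReal.coe_toNNReal hC] at this
    simp only [mul_comm (g _)]
    exact this.trans ((mul_le_mul' le_rfl hg1).trans (mul_one _).le)
  · by_cases hA : kotheDualNorm (nBarSpace n α s r q) (nBarNorm α s r q) f = ∞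
    · rw [hA]; exact le_top
    rw [← ENNReal.coe_toNNReal hA, mNorm_le_iff hs0 hr hpq.pos]
    intro h hh
    rw [ENNReal.coe_toNNReal hA]
    exact lintegral_rieszPotential_rpow_le_of_dual hs hα hαn hr hrs hpq hf
      (fun g hg hg1 => le_kotheDualNorm hg hg1 f) hh

end

end RieszMultiplier


/-! ### The duality theorem -/

theorem mainTheorem9 (n : ℕ) (α s r p : ℝ) (hs : 1 < s) (hα : 0 < α) (hαn : α < (n : ℝ) / s)
    (hr : 0 < r) (hrs : r ≤ s) (hp : 1 < p) :
    RieszMultiplier.IsometricallyEqual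
      (RieszMultiplier.nBarSpace n α s r (p / (p - 1)))
      (RieszMultiplier.nBarNorm α s r (p / (p - 1)))
      (RieszMultiplier.kotheDual (RieszMultiplier.mSpace n α s p r))
      (RieszMultiplier.kotheDualNorm (RieszMultiplier.mSpace n α s p r)
        (RieszMultiplier.mNorm α s p r)) ∧
    RieszMultiplier.IsometricallyEqual
      (RieszMultiplier.kotheDual (RieszMultiplier.nBarSpace n α s r (p / (p - 1))))
      (RieszMultiplier.kotheDualNorm (RieszMultiplier.nBarSpace n α s r (p / (p - 1)))
        (RieszMultiplier.nBarNorm α s r (p / (p - 1))))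
      (RieszMultiplier.mSpace n α s p r)
      (RieszMultiplier.mNorm α s p r) := by
  have hpq : p.HolderConjugate (p / (p - 1)) := Real.HolderConjugate.conjExponent hp
  refine ⟨⟨?_, fun g hg => RieszMultiplier.nBarNorm_eq_kotheDualNorm hs hα hαn hr hrs hpq hg⟩,
    ?_, fun f hf => RieszMultiplier.kotheDualNorm_eq_mNorm hs hα hαn hr hrs hpq hf⟩
  · ext g
    refine ⟨fun hg => ⟨hg.1, fun f hf =>
      RieszMultiplier.integrable_mul_of_mem hs hα hαn hr hpq hf hg⟩, fun hg => ⟨hg.1, ?_⟩⟩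
    rw [RieszMultiplier.nBarNorm_eq_kotheDualNorm hs hα hαn hr hrs hpq hg.1]
    exact RieszMultiplier.kotheDualNorm_mSpace_lt_top hs hα hαn hr hp hg
  · ext f
    rw [RieszMultiplier.mem_mSpace_iff hs hα hαn hr hpq.pos]
    refine ⟨fun hf => ⟨hf.1, ?_⟩, fun hf => ⟨hf.1, fun g hg => ?_⟩⟩
    · rw [← RieszMultiplier.kotheDualNorm_eq_mNorm hs hα hαn hr hrs hpq hf.1]
      exact RieszMultiplier.kotheDualNorm_nBarSpace_lt_top hs hα hαn hr hrs hpq.symm.lt hf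
    · have := RieszMultiplier.integrable_mul_of_mem hs hα hαn hr hpq
        ((RieszMultiplier.mem_mSpace_iff hs hα hαn hr hpq.pos).2 hf) hg
      simpa only [mul_comm (g _)] using this
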